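/- **Setting.** Let $X_1,\dots,X_{n_+}\in\mathbb R^{d_0}$ be positive examples ($i\in\mathcal S_+$) and let $\mathcal S_-$ be a family of $n_-$ negative examples $X_j\in\mathbb R^{d_0}$. Let $h_{\mathbf w}(X)\in\mathbb R$ be the score of $X$ with parameter $\mathbf w\in\mathbb R^d$, let $\ell:\mathbb R\to\mathbb R$, and let $\alpha,\beta\in(0,1]$. Put $$f(g,s')=s'+\frac{(g-s')_+}{\alpha},\qquad \psi_i(\mathbf w,s_i;X_j)=s_i+\frac{(\ell(h_{\mathbf w}(X_j)-h_{\mathbf w}(X_i))-s_i)_+}{\beta},$$ $$\psi_i(\mathbf w,s_i)=\frac1{n_-}\sum_{j\in\mathcal S_-}\psi_i(\mathbf w,s_i;X_j),\qquad F(\mathbf w,\mathbf s,s')=\frac1{n_+}\sum_{i\in\mathcal S_+}f(\psi_i(\mathbf w,s_i),s').$$ A function $\varphi$ is called $\rho$-weakly convex if $\varphi+\frac\rho2\|\cdot\|^2$ is convex; $v$ is a subgradient of $\varphi$ at $x$ if $\varphi(y)\ge\varphi(x)+\langle v,y-x\rangle+o(\|y-x\|)$ as $y\to x$; and $F_\lambda(z)=\min_y\{F(y)+\frac1{2\lambda}\|y-z\|^2\}$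 is the Moreau envelope of $F$ in the joint variable $z=(\mathbf w,\mathbf s,s')$ with the Euclidean norm. **Assumptions.** $\ell$ is non-decreasing, $C_\ell$-Lipschitz and $\rho_\ell$-weakly convex. For all examples, $\mathbf w\mapsto h_{\mathbf w}(X)$ is $C_h$-Lipschitz. $h_{\mathbf w}(X_j)$ is $\rho_h$-weakly convex in $\mathbf w$ for the negative examples and $-h_{\mathbf w}(X_i)$ is $\rho_h$-weakly convex in $\mathbf w$ for the positive ones (both hold if $\mathbf w\mapsto h_{\mathbf w}(X)$ is $\rho_h$-smooth for all examples). All these constants are $\ge0$. The sampling variance is bounded: $\frac1{n_-}\sum_j(\psi_i(\mathbf w,s_i;X_j)-\psi_i(\mathbf w,s_i))^2\le\sigma^2$ for all $i,\mathbf w,s_i$. **Algorithm (SONX for TPAUC).** Start from $\mathbf w_0,\mathbf s_0,s'_0,(u_{i,0})_i$, with $\mathbf w_{-1}=\mathbf w_0$, $\mathbf s_{-1}=\mathbf s_0$. For $t=0,\dots,T-1$ draw, independently of each other and of the past, uniformly random subsets $\mathcal B_1^t\subset\mathcal S_+$ of size $B_1$ and $\mathcal B_2^t\subset\mathcal S_-$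 of size $B_2$. With $\psi_i(\cdot;\mathcal B)$ and $\partial\psi_i(\cdot;\mathcal B)$ the averages over $j\in\mathcal B$ of $\psi_i(\cdot;X_j)$ and of chosen subgradients $(\partial_w,\partial_s)\psi_i(\cdot;X_j)$ in $(\mathbf w,s_i)$, and $(\partial_u f,\partial_{s'}f)$ a chosen subgradient of $f$, set for $i\in\mathcal B_1^t$ $$u_{i,t+1}=(1-\tau)u_{i,t}+\tau\psi_i(\mathbf w_t,s_{i,t};\mathcal B_2^t)+\gamma\big(\psi_i(\mathbf w_t,s_{i,t};\mathcal B_2^t)-\psi_i(\mathbf w_{t-1},s_{i,t-1};\mathcal B_2^t)\big),$$ $$s_{i,t+1}=s_{i,t}-\tfrac{\eta}{B_1}\,\partial_s\psi_i(\mathbf w_t,s_{i,t};\mathcal B_2^t)\,\partial_uf(u_{i,t},s'_t),$$ leave $u_i,s_i$ unchanged for $i\notin\mathcal B_1^t$, and set $$s'_{t+1}=s'_t-\tfrac{\eta}{B_1}\sum_{i\in\mathcal B_1^t}\partial_{s'}f(u_{i,t},s'_t),\qquad \mathbf w_{t+1}=\mathbf w_t-\tfrac{\eta}{B_1}\sum_{i\in\mathcal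 B_1^t}\partial_w\psi_i(\mathbf w_t,s_{i,t};\mathcal B_2^t)\,\partial_uf(u_{i,t},s'_t).$$ The output is the iterate with index $\bar t$ uniform on $\{0,\dots,T-1\}$, independent of the samples. **Theorem.** (a) Every $\psi_i$ is weakly convex in $(\mathbf w,s_i)$ with modulus $(4\rho_\ell C_h^2+2\rho_hC_\ell)/\beta$, and $F$ is weakly convex in $(\mathbf w,\mathbf s,s')$ with modulus $(4\rho_\ell C_h^2+2\rho_hC_\ell)/(\alpha\beta)$. (b) Let $\rho_\psi,\rho_F\ge0$ be any constants such that every $\psi_i$ is $\rho_\psi$-weakly convex and $F$ is $\rho_F$-weakly convex, let $f(\cdot,s')$ be $C_f$-Lipschitz for all $s'$, and let $\bar\rho=\rho_F+\rho_\psi C_f>0$. Suppose that $\frac1{n_+}\sum_i|u_{i,0}-\psi_i(\mathbf w_0,s_{i,0})|\le E_0$ and $F_{1/\bar\rho}(\mathbf w_0,\mathbf s_0,s'_0)-\inf F_{1/\bar\rho}\le\Delta$. Take $1\le B_1\le n_+$, $1\le B_2\le n_-$, $\varepsilon>0$, $$\tau=c_\tau B_2\varepsilon^4\le\tfrac12,\qquad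 \eta=c_\eta\frac{B_1B_2^{1/2}\varepsilon^4}{n_+},\qquad \gamma=\frac{n_+-B_1}{B_1(1-\tau)}+(1-\tau).$$ Then for every sufficiently small $c_\tau>0$, for every $c_\eta>0$ sufficiently small depending on $c_\tau$, there is a constant $C$ such that for all $T\ge C\,\frac{n_+}{B_1B_2^{1/2}}\varepsilon^{-6}$ the envelope $F_{1/\bar\rho}$ is differentiable and $$\mathbb E\big[\|\nabla F_{1/\bar\rho}(\mathbf w_{\bar t},\mathbf s_{\bar t},s'_{\bar t})\|^2\big]=\frac1T\sum_{t=0}^{T-1}\mathbb E\big[\|\nabla F_{1/\bar\rho}(\mathbf w_t,\mathbf s_t,s'_t)\|^2\big]\le\varepsilon^2 .$$ Besides the stated dependence on $c_\tau$ and $c_\eta$, the thresholds on $c_\tau,c_\eta$ and the constant $C$ depend only on $\alpha,\beta,C_\ell,\rho_\ell,C_h,\rho_h,C_f,\rho_\psi,\rho_F,\sigma,\Delta,E_0$; in particular not on $\varepsilon,n_\pm,B_1,B_2,d$, the data or the choice of subgradients. Thus an $\varepsilon$-stationary point of $F_{1/\bar\rho}$ is reached within $T=O\big(\frac{n_+}{B_1B_2^{1/2}}\varepsilon^{-6}\big)$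 iterations. -/

import Mathlib

open scoped BigOperators

noncomputable section

namespace TPAUC

/-- `ℝ^n` with the Euclidean norm. -/
abbrev Vec (n : ℕ) : Type := EuclideanSpace ℝ (Fin n)

/-- The product of two Euclidean spaces, with `‖(x, y)‖² = ‖x‖² + ‖y‖²`. -/
abbrev Prod2 (E F : Type) : Type := WithLp 2 (E × F)

/-- The pair `(x, y)` as a point of the Euclidean product. -/
abbrev pair {E F : Type} (x : E) (y : F) : Prod2 E F := WithLp.toLp 2 (x, y)

section General

variable {E : Type} [NormedAddCommGroup E] [InnerProductSpace ℝ E]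

/-- `φ` is `ρ`-weakly convex: `φ + (ρ/2)‖·‖²` is convex. -/
def WeaklyConvex (ρ : ℝ) (φ : E → ℝ) : Prop :=
  ConvexOn ℝ Set.univ (fun x => φ x + ρ / 2 * ‖x‖ ^ 2)

/-- `v` is a (regular) subgradient of `φ` at `x`:
`φ y ≥ φ x + ⟪v, y - x⟫ + o(‖y - x‖)` as `y → x`. -/
def IsSubgradient (φ : E → ℝ) (x v : E) : Prop :=
  ∀ c : ℝ, 0 < c → ∀ᶠ y in nhds x, φ x + inner ℝ v (y - x) - c * ‖y - x‖ ≤ φ y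

/-- The Moreau envelope `φ_lam x = min_y (φ y + ‖y - x‖² / (2 lam))`. -/
def moreau (lam : ℝ) (φ : E → ℝ) (x : E) : ℝ :=
  ⨅ y : E, (φ y + 1 / (2 * lam) * ‖y - x‖ ^ 2)

end General

/-- The outer function `f(g, s') = s' + (g - s')₊ / α`. -/
def outer (α g s' : ℝ) : ℝ := s' + max (g - s') 0 / α

/-- The data of a two-way partial AUC problem in the regular (one instance per example) setting:
the score `h w X`, the positive and the negative examples, the surrogate loss and the two
parameters `α`, `β`. -/
structure Problem (d d₀ np nm : ℕ) where
  h : Vec d → Vec d₀ → ℝ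
  pos : Fin np → Vec d₀
  neg : Fin nm → Vec d₀
  loss : ℝ → ℝ
  α : ℝ
  β : ℝ

/-- The space of all variables `(w, (s, s'))`, with the joint Euclidean norm. -/
abbrev Var (d np : ℕ) : Type := Prod2 (Vec d) (Prod2 (Vec np) ℝ)

/-- An (unordered) pair of mini-batches: `B₁` positive and `B₂` negative examples,
drawn without replacement. -/
abbrev Batch (np nm B₁ B₂ : ℕ) : Type :=
  {b : Finset (Fin np) // b.card = B₁} × {b : Finset (Fin nm) // b.card = B₂}

/-- The memory of the algorithm before iteration `t`: the iterates `w_t`, `s_t`, `s'_t`,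
the previous iterates `w_{t-1}`, `s_{t-1}`, and the estimators `u_t`. -/
structure State (d np : ℕ) where
  w : Vec d
  s : Vec np
  s' : ℝ
  wPrev : Vec d
  sPrev : Vec np
  u : Fin np → ℝ

/-- The current point `(w_t, s_t, s'_t)`. -/
def State.var {d np : ℕ} (x : State d np) : Var d np := pair x.w (pair x.s x.s')

/-- The state before iteration `0`; by convention `w_{-1} = w_0` and `s_{-1} = s_0`. -/
def State.init {d np : ℕ} (w₀ : Vec d) (s₀ : Vec np) (s'₀ : ℝ) (u₀ : Fin np → ℝ) : State d np :=
  ⟨w₀, s₀, s'₀, w₀, s₀, u₀⟩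

namespace Problem

variable {d d₀ np nm : ℕ} (P : Problem d d₀ np nm)

/-- The single-sample value `ψ_i(w, s_i; X_j) = s_i + (ℓ(h_w(X_j) - h_w(X_i)) - s_i)₊ / β`. -/
def psiSample (i : Fin np) (j : Fin nm) (w : Vec d) (si : ℝ) : ℝ :=
  si + max (P.loss (P.h w (P.neg j) - P.h w (P.pos i)) - si) 0 / P.β

/-- `ψ_i(w, s_i)`, the average of `ψ_i(w, s_i; X_j)` over all negative examples. -/
def psi (i : Fin np) (w : Vec d) (si : ℝ) : ℝ :=
  1 / (nm : ℝ) * ∑ j : Fin nm, P.psiSample i j w si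

/-- The mini-batch estimator `ψ_i(w, s_i; b)`. -/
def psiBatch (i : Fin np) (b : Finset (Fin nm)) (w : Vec d) (si : ℝ) : ℝ :=
  1 / (b.card : ℝ) * ∑ j ∈ b, P.psiSample i j w si

/-- The objective `F(w, s, s') = (1/n₊) ∑_i f(ψ_i(w, s_i), s')`. -/
def objective (z : Var d np) : ℝ :=
  1 / (np : ℝ) * ∑ i : Fin np, outer P.α (P.psi i z.fst (z.snd.fst i)) z.snd.snd

/-- The conditions on the loss and on the scores. The convexity requirements on
the scores hold for instance when every `w ↦ h w X` is `ρh`-smooth. -/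
structure Regular (Cl ρl Ch ρh : ℝ) : Prop where
  loss_mono : Monotone P.loss
  loss_lip : ∀ x y : ℝ, |P.loss x - P.loss y| ≤ Cl * |x - y|
  loss_wc : WeaklyConvex ρl P.loss
  pos_lip : ∀ i w w', |P.h w (P.pos i) - P.h w' (P.pos i)| ≤ Ch * ‖w - w'‖
  neg_lip : ∀ j w w', |P.h w (P.neg j) - P.h w' (P.neg j)| ≤ Ch * ‖w - w'‖
  neg_wc : ∀ j, WeaklyConvex ρh (fun w => P.h w (P.neg j))
  pos_wc : ∀ i, WeaklyConvex ρh (fun w => -P.h w (P.pos i))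

/-- Every `ψ_i` is `ρ`-weakly convex, jointly in `(w, s_i)`. -/
def PsiWeaklyConvex (ρ : ℝ) : Prop :=
  ∀ i : Fin np, WeaklyConvex ρ (fun p : Prod2 (Vec d) ℝ => P.psi i p.fst p.snd)

/-- For uniform `j`, the estimator `ψ_i(w, s_i; X_j)` of `ψ_i(w, s_i)` has variance
at most `σ²`. -/
def BoundedVariance (σ : ℝ) : Prop :=
  ∀ (i : Fin np) (w : Vec d) (si : ℝ),
    1 / (nm : ℝ) * ∑ j : Fin nm, (P.psiSample i j w si - P.psi i w si) ^ 2 ≤ σ ^ 2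

/-- A choice of the subgradients that the algorithm uses: at each point, one subgradient
`(∂_u f, ∂_{s'} f)` of the outer function and, for each pair of examples, one subgradient
`(∂_w ψ_i, ∂_s ψ_i)` of the single-sample function. -/
structure Oracle where
  df : ℝ → ℝ → Prod2 ℝ ℝ
  df_spec : ∀ u s', IsSubgradient (fun p : Prod2 ℝ ℝ => outer P.α p.fst p.snd)
    (pair u s') (df u s')
  dpsi : Fin np → Fin nm → Vec d → ℝ → Prod2 (Vec d) ℝ
  dpsi_spec : ∀ i j w si,
    IsSubgradient (fun p : Prod2 (Vec d) ℝ => P.psiSample i j p.fst p.snd)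
      (pair w si) (dpsi i j w si)

variable {P}

/-- The mini-batch subgradient `∂ψ_i(w, s_i; b)`. -/
def Oracle.dpsiBatch (O : P.Oracle) (i : Fin np) (b : Finset (Fin nm)) (w : Vec d) (si : ℝ) :
    Prod2 (Vec d) ℝ :=
  (1 / (b.card : ℝ)) • ∑ j ∈ b, O.dpsi i j w si

/-- One iteration with the mini-batches `b`. -/
def Oracle.step (O : P.Oracle) {B₁ B₂ : ℕ} (τ γ η : ℝ) (b : Batch np nm B₁ B₂)
    (x : State d np) : State d np where
  w := x.w - η • ((1 / (B₁ : ℝ)) •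
    ∑ i ∈ b.1.1, (O.df (x.u i) x.s').fst • (O.dpsiBatch i b.2.1 x.w (x.s i)).fst)
  s := WithLp.toLp 2 fun i =>
    if i ∈ b.1.1 then
      x.s i - η * (1 / (B₁ : ℝ)) *
        ((O.dpsiBatch i b.2.1 x.w (x.s i)).snd * (O.df (x.u i) x.s').fst)
    else x.s i
  s' := x.s' - η * (1 / (B₁ : ℝ)) * ∑ i ∈ b.1.1, (O.df (x.u i) x.s').snd
  wPrev := x.w
  sPrev := x.s
  u := fun i =>
    if i ∈ b.1.1 then
      (1 - τ) * x.u i + τ * P.psiBatch i b.2.1 x.w (x.s i)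
        + γ * (P.psiBatch i b.2.1 x.w (x.s i) - P.psiBatch i b.2.1 x.wPrev (x.sPrev i))
    else x.u i

/-- The state before iteration `t ≤ T`, when the mini-batches are `ω 0, …, ω (T - 1)`. -/
def Oracle.run (O : P.Oracle) {B₁ B₂ T : ℕ} (τ γ η : ℝ) (x₀ : State d np)
    (ω : Fin T → Batch np nm B₁ B₂) (t : Fin (T + 1)) : State d np :=
  Fin.induction (motive := fun _ => State d np) x₀ (fun t x => O.step τ γ η (ω t) x) t

/-- The expectation of `φ` at the returned point `(w, s, s')`: the `T` pairs of mini-batches are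
independent and uniform, and the index of the returned iterate is uniform in `{0, …, T - 1}`,
independently of them. -/
def Oracle.expectOutput (O : P.Oracle) (B₁ B₂ T : ℕ) (τ γ η : ℝ) (x₀ : State d np)
    (φ : Var d np → ℝ) : ℝ :=
  𝔼 t : Fin T, 𝔼 ω : Fin T → Batch np nm B₁ B₂, φ (O.run τ γ η x₀ ω t.castSucc).var

end Problem

end TPAUC

end

/-!
Each `ψ_i` is `s_i + (ℓ(h_w(X_j) - h_w(X_i)) - s_i)₊ / β` averaged over `j`. A supporting parabola of
the monotone loss shows that the composition with a Lipschitz, weakly convex score difference is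
weakly convex (`WeaklyConvex.comp_monotone`), and the outer function, convex and non-decreasing in
its first argument with slopes at most `1 / α`, passes this on to `F`
(`PsiWeaklyConvex.objective`).

For the convergence, the proximal point `ẑ` of the current iterate `z` gives the gradient
`ρbar (z - ẑ)` of the envelope (`IsProx.hasGradientAt`). Convexity of `f`, weak convexity of `ψ_i`
and quadratic growth of the proximal objective bound the inner product of the expected update
direction with `ẑ - z` by `2 Cf · err - (ρbar / 2) ‖ẑ - z‖²`, where `err` is the mean of
`|u_i - ψ_i(z)|`; the modulus `ρbar = ρF + ρψ Cf` is exactly what makes the quadratic terms fit. The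
envelope therefore decreases in expectation by `(η / 2) ‖∇F_{1/ρbar}‖²`, up to `err` and a term of
order `η²` (`Oracle.expect_moreau_step_le`).

The error `err` is controlled by `u_i - ψ_i` at the previous iterate. The weight `γ` cancels the
cross term between this error and the increment of `ψ_i`, so that its mean square contracts by
`1 - τ B₁ / n₊` per step, with a noise of order `τ² σ² / B₂` from sampling without replacement and a
drift of order `η²` (`Oracle.expect_trackingError_sq_le`). Only the mean of the initial absolute
errors is bounded, so the recursion is solved for each `i` before averaging over `i`
(`Oracle.expect_estimationError_le`). Telescoping gives the bound `Oracle.expectOutput_le`, and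
`final_bound_le` inserts the parameters.
-/

noncomputable section

namespace TPAUC

/-! ### Weakly convex functions and Moreau envelopes -/

section General

variable {E : Type} [NormedAddCommGroup E] [InnerProductSpace ℝ E]

theorem norm_sq_convex_comb (x y : E) {a b : ℝ} (hab : a + b = 1) :
    ‖a • x + b • y‖ ^ 2 = a * ‖x‖ ^ 2 + b * ‖y‖ ^ 2 - a * b * ‖x - y‖ ^ 2 := by
  have hb : b = 1 - a := by linarith
  subst hb
  rw [norm_add_sq_real, norm_sub_sq_real, norm_smul, norm_smul, real_inner_smul_left,
    real_inner_smul_right, mul_pow, mul_pow, Real.norm_eq_abs, Real.norm_eq_abs, sq_abs, sq_abs]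
  ring

/-- Weak convexity as a relaxed Jensen inequality, without the quadratic added. -/
theorem weaklyConvex_iff {ρ : ℝ} {φ : E → ℝ} :
    WeaklyConvex ρ φ ↔ ∀ x y : E, ∀ a b : ℝ, 0 ≤ a → 0 ≤ b → a + b = 1 →
      φ (a • x + b • y) ≤ a * φ x + b * φ y + ρ / 2 * (a * b * ‖x - y‖ ^ 2) := by
  constructor
  · intro h x y a b ha hb hab
    have := h.2 (Set.mem_univ x) (Set.mem_univ y) ha hb hab
    simp only [smul_eq_mul] at this
    rw [norm_sq_convex_comb x y hab] at this
    linarith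
  · intro h
    refine ⟨convex_univ, fun x _ y _ a b ha hb hab => ?_⟩
    have := h x y a b ha hb hab
    simp only [smul_eq_mul]
    rw [norm_sq_convex_comb x y hab]
    linarith

/-- A regular subgradient of a weakly convex function gives a global quadratic minorant. -/
theorem WeaklyConvex.le_of_isSubgradient {ρ : ℝ} {φ : E → ℝ} (h : WeaklyConvex ρ φ) {x v : E}
    (hv : IsSubgradient φ x v) (y : E) :
    φ x + inner ℝ v (y - x) - ρ / 2 * ‖y - x‖ ^ 2 ≤ φ y := by
  rw [weaklyConvex_iff] at h
  have key : ∀ c : ℝ, 0 < c →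
      φ x + inner ℝ v (y - x) - c * ‖y - x‖ - ρ / 2 * ‖y - x‖ ^ 2 ≤ φ y := by
    intro c hc
    have htend : Filter.Tendsto (fun a : ℝ => x + a • (y - x)) (nhdsWithin 0 (Set.Ioi 0))
        (nhds x) := by
      have : Continuous fun a : ℝ => x + a • (y - x) := by fun_prop
      simpa using (this.tendsto 0).mono_left nhdsWithin_le_nhds
    have hev := htend.eventually (hv c hc)
    have hlt : ∀ᶠ a : ℝ in nhdsWithin 0 (Set.Ioi 0), a < 1 :=
      nhdsWithin_le_nhds (Iio_mem_nhds one_pos)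
    have hcont : Filter.Tendsto
        (fun a : ℝ => φ x + inner ℝ v (y - x) - c * ‖y - x‖ - ρ / 2 * ((1 - a) * ‖y - x‖ ^ 2))
        (nhdsWithin 0 (Set.Ioi 0))
        (nhds (φ x + inner ℝ v (y - x) - c * ‖y - x‖ - ρ / 2 * ‖y - x‖ ^ 2)) := by
      have : Continuous fun a : ℝ =>
        φ x + inner ℝ v (y - x) - c * ‖y - x‖ - ρ / 2 * ((1 - a) * ‖y - x‖ ^ 2) := by fun_prop
      simpa using (this.tendsto 0).mono_left nhdsWithin_le_nhds
    refine le_of_tendsto hcont ?_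
    filter_upwards [hev, hlt, self_mem_nhdsWithin] with a h1 h2 (h3 : 0 < a)
    have h4 := h x y (1 - a) a (by linarith) h3.le (by ring)
    have e : (1 - a) • x + a • y = x + a • (y - x) := by module
    rw [e] at h4
    rw [add_sub_cancel_left, real_inner_smul_right, norm_smul, Real.norm_of_nonneg h3.le] at h1
    rw [norm_sub_rev] at h4
    have h5 := h1.trans h4
    refine le_of_mul_le_mul_left ?_ h3
    linarith
  refine le_of_forall_pos_le_add fun e he => ?_
  have := key (e / (‖y - x‖ + 1)) (by positivity)
  have h2 : e / (‖y - x‖ + 1) * ‖y - x‖ ≤ e := by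
    rw [div_mul_eq_mul_div, div_le_iff₀ (by positivity)]
    nlinarith [norm_nonneg (y - x)]
  linarith

/-- Subgradients of a `K`-Lipschitz function have norm at most `K`. -/
theorem IsSubgradient.norm_le {φ : E → ℝ} {x v : E} (hv : IsSubgradient φ x v) {K : ℝ}
    (hK : 0 ≤ K) (hφ : ∀ y, φ y - φ x ≤ K * ‖y - x‖) : ‖v‖ ≤ K := by
  refine le_of_forall_pos_le_add fun c hc => ?_
  rcases eq_or_ne v 0 with rfl | hv0
  · simpa using by positivity
  have htend : Filter.Tendsto (fun a : ℝ => x + a • v) (nhdsWithin 0 (Set.Ioi 0)) (nhds x) := by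
    have : Continuous fun a : ℝ => x + a • v := by fun_prop
    simpa using (this.tendsto 0).mono_left nhdsWithin_le_nhds
  obtain ⟨a, h1, h3⟩ := ((htend.eventually (hv c hc)).and self_mem_nhdsWithin).exists
  have h3 : 0 < a := h3
  have h2 := hφ (x + a • v)
  rw [add_sub_cancel_left, norm_smul, Real.norm_of_nonneg h3.le] at h1 h2
  rw [real_inner_smul_right, real_inner_self_eq_norm_sq] at h1
  have hpos : 0 < a * ‖v‖ := mul_pos h3 (norm_pos_iff.2 hv0)
  refine le_of_mul_le_mul_left ?_ hpos
  nlinarith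

theorem IsSubgradient.sum {ι : Type} (t : Finset ι) {φ : ι → E → ℝ} {x : E} {v : ι → E}
    (h : ∀ j ∈ t, IsSubgradient (φ j) x (v j)) :
    IsSubgradient (fun y => ∑ j ∈ t, φ j y) x (∑ j ∈ t, v j) := by
  intro c hc
  have hc' : 0 < c / (t.card + 1) := by positivity
  have : ∀ᶠ y in nhds x, ∀ j ∈ t,
      φ j x + inner ℝ (v j) (y - x) - c / (t.card + 1) * ‖y - x‖ ≤ φ j y :=
    (Filter.eventually_all_finset t).2 fun j hj => h j hj _ hc'
  filter_upwards [this] with y hy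
  have h1 := Finset.sum_le_sum hy
  rw [Finset.sum_sub_distrib, Finset.sum_add_distrib, ← sum_inner, Finset.sum_const,
    nsmul_eq_mul] at h1
  have h2 : (t.card : ℝ) * (c / (t.card + 1) * ‖y - x‖) ≤ c * ‖y - x‖ := by
    rw [← mul_assoc]
    gcongr
    rw [mul_div_assoc', div_le_iff₀ (by positivity)]
    nlinarith
  linarith

theorem IsSubgradient.const_mul {φ : E → ℝ} {x v : E} (h : IsSubgradient φ x v) {r : ℝ}
    (hr : 0 ≤ r) : IsSubgradient (fun y => r * φ y) x (r • v) := by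
  intro c hc
  have hc' : 0 < c / (r + 1) := by positivity
  filter_upwards [h _ hc'] with y hy
  have h1 := mul_le_mul_of_nonneg_left hy hr
  have h2 : r * (c / (r + 1) * ‖y - x‖) ≤ c * ‖y - x‖ := by
    rw [← mul_assoc]
    gcongr
    rw [mul_div_assoc', div_le_iff₀ (by positivity)]
    nlinarith
  rw [real_inner_smul_left]
  linarith

theorem WeaklyConvex.average {m : ℕ} {ρ : ℝ} (hρ : 0 ≤ ρ) {φ : Fin m → E → ℝ}
    (h : ∀ j, WeaklyConvex ρ (φ j)) : WeaklyConvex ρ (fun x => 1 / (m : ℝ) * ∑ j, φ j x) := by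
  rw [weaklyConvex_iff]
  intro x y a b ha hb hab
  have h1 := Finset.sum_le_sum fun j (_ : j ∈ Finset.univ) =>
    weaklyConvex_iff.1 (h j) x y a b ha hb hab
  rw [Finset.sum_add_distrib, Finset.sum_add_distrib, ← Finset.mul_sum, ← Finset.mul_sum,
    Finset.sum_const, Finset.card_univ, Fintype.card_fin, nsmul_eq_mul] at h1
  have h2 := mul_le_mul_of_nonneg_left h1 (show (0 : ℝ) ≤ 1 / (m : ℝ) by positivity)
  have h3 : 1 / (m : ℝ) * (m * (ρ / 2 * (a * b * ‖x - y‖ ^ 2))) ≤ ρ / 2 * (a * b * ‖x - y‖ ^ 2) := by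
    rw [← mul_assoc]
    refine mul_le_of_le_one_left (by positivity) ?_
    rw [one_div]
    exact inv_mul_le_one
  linarith

/-- `p` is a proximal point of `φ` at `x`: it attains the infimum that defines the Moreau envelope
with parameter `1 / ρ`. -/
def IsProx {G : Type} [NormedAddCommGroup G] (ρ : ℝ) (φ : G → ℝ) (x p : G) : Prop :=
  ∀ y, φ p + ρ / 2 * ‖p - x‖ ^ 2 ≤ φ y + ρ / 2 * ‖y - x‖ ^ 2

theorem exists_isProx [FiniteDimensional ℝ E] {ρ K : ℝ} (hρ : 0 < ρ) (hK : 0 ≤ K) {φ : E → ℝ}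
    (hφ : ∀ x y, |φ x - φ y| ≤ K * ‖x - y‖) (x : E) : ∃ p, IsProx ρ φ x p := by
  have hc : Continuous φ := by
    refine (LipschitzWith.of_dist_le_mul (K := K.toNNReal) fun y z => ?_).continuous
    rw [Real.dist_eq, dist_eq_norm, Real.coe_toNNReal _ hK]
    exact hφ y z
  have hR : 0 ≤ 2 * K / ρ := by positivity
  obtain ⟨p, hp, hmin⟩ := (isCompact_closedBall x (2 * K / ρ)).exists_isMinOn
    ⟨x, Metric.mem_closedBall_self hR⟩
    (f := fun y => φ y + ρ / 2 * ‖y - x‖ ^ 2) (by fun_prop)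
  refine ⟨p, fun y => ?_⟩
  -- Beyond this radius the quadratic term outweighs the decrease of `φ`.
  by_cases hy : y ∈ Metric.closedBall x (2 * K / ρ)
  · exact hmin hy
  · have h1 : φ p + ρ / 2 * ‖p - x‖ ^ 2 ≤ φ x + ρ / 2 * ‖x - x‖ ^ 2 :=
      hmin (Metric.mem_closedBall_self hR)
    rw [Metric.mem_closedBall, dist_eq_norm, not_le, div_lt_iff₀ hρ] at hy
    have h2 := (abs_le.1 (hφ x y)).2
    rw [norm_sub_rev] at h2
    simp only [sub_self, norm_zero] at h1
    nlinarith [norm_nonneg (y - x)]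

theorem IsProx.moreau_eq {G : Type} [NormedAddCommGroup G] {ρ : ℝ} {φ : G → ℝ} {x p : G}
    (hp : IsProx ρ φ x p) :
    moreau (1 / ρ) φ x = φ p + ρ / 2 * ‖p - x‖ ^ 2 := by
  have e : 1 / (2 * (1 / ρ)) = ρ / 2 := by
    rcases eq_or_ne ρ 0 with rfl | h
    · simp
    · field_simp
  unfold moreau
  rw [e]
  refine le_antisymm (ciInf_le ⟨φ p + ρ / 2 * ‖p - x‖ ^ 2, ?_⟩ p) (le_ciInf hp)
  rintro _ ⟨y, rfl⟩
  exact hp y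

/-- The proximal objective grows quadratically around a proximal point. -/
theorem IsProx.growth {ρ ρ' : ℝ} {φ : E → ℝ} {x p : E} (hp : IsProx ρ φ x p)
    (hφ : WeaklyConvex ρ' φ) (y : E) :
    φ p + ρ / 2 * ‖p - x‖ ^ 2 + (ρ - ρ') / 2 * ‖y - p‖ ^ 2 ≤ φ y + ρ / 2 * ‖y - x‖ ^ 2 := by
  rw [weaklyConvex_iff] at hφ
  have hcont : Filter.Tendsto
      (fun a : ℝ => φ p + ρ / 2 * ‖p - x‖ ^ 2 + (ρ - ρ') / 2 * ((1 - a) * ‖y - p‖ ^ 2))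
      (nhdsWithin 0 (Set.Ioi 0))
      (nhds (φ p + ρ / 2 * ‖p - x‖ ^ 2 + (ρ - ρ') / 2 * ‖y - p‖ ^ 2)) := by
    have : Continuous fun a : ℝ =>
      φ p + ρ / 2 * ‖p - x‖ ^ 2 + (ρ - ρ') / 2 * ((1 - a) * ‖y - p‖ ^ 2) := by fun_prop
    simpa using (this.tendsto 0).mono_left nhdsWithin_le_nhds
  have hlt : ∀ᶠ a : ℝ in nhdsWithin 0 (Set.Ioi 0), a < 1 :=
    nhdsWithin_le_nhds (Iio_mem_nhds one_pos)
  refine le_of_tendsto hcont ?_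
  filter_upwards [hlt, self_mem_nhdsWithin] with a h2 (h3 : 0 < a)
  have h4 := hφ p y (1 - a) a (by linarith) h3.le (by ring)
  have h5 := hp ((1 - a) • p + a • y)
  have e : (1 - a) • p + a • y - x = (1 - a) • (p - x) + a • (y - x) := by module
  rw [e, norm_sq_convex_comb _ _ (by ring : 1 - a + a = 1), sub_sub_sub_cancel_right] at h5
  rw [norm_sub_rev] at h4 h5
  rw [norm_sub_rev p y] at h5
  rw [norm_sub_rev x p] at h5
  refine le_of_mul_le_mul_left ?_ h3
  linarith

/-- The proximal point of `x` is a competitor in the infimum at `y`, which gives a quadratic upper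
bound on the envelope. -/
theorem IsProx.moreau_le {ρ : ℝ} {φ : E → ℝ} {x p : E} (hp : IsProx ρ φ x p) {y q : E}
    (hq : IsProx ρ φ y q) :
    moreau (1 / ρ) φ y ≤ moreau (1 / ρ) φ x - ρ * inner ℝ (p - x) (y - x)
      + ρ / 2 * ‖y - x‖ ^ 2 := by
  rw [hq.moreau_eq, hp.moreau_eq]
  have h := hq p
  have e : p - y = (p - x) - (y - x) := by abel
  rw [e, norm_sub_sq_real (p - x)] at h
  linarith

/-- The Moreau envelope of a `ρ'`-weakly convex function with `ρ' < ρ` is differentiable, with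
gradient `ρ (x - p)` for the proximal point `p`. The proximal map is Lipschitz, so the quadratic
bounds of `IsProx.moreau_le` at `x` and at the nearby point sandwich the envelope. -/
theorem IsProx.hasGradientAt [CompleteSpace E] {ρ ρ' : ℝ} (hρ : 0 < ρ) (hρ' : ρ' < ρ) {φ : E → ℝ}
    (hφ : WeaklyConvex ρ' φ) {prox : E → E} (hprox : ∀ x, IsProx ρ φ x (prox x)) (x : E) :
    HasGradientAt (moreau (1 / ρ) φ) (ρ • (x - prox x)) x := by
  have hlip : ∀ y, ‖prox y - prox x‖ ≤ ρ / (ρ - ρ') * ‖y - x‖ := by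
    intro y
    have h1 := (hprox x).growth hφ (prox y)
    have h2 := (hprox y).growth hφ (prox x)
    have e1 : prox x - y = (prox x - x) - (y - x) := by abel
    have e2 : prox y - y = (prox y - x) - (y - x) := by abel
    rw [e1, e2, norm_sub_sq_real (prox x - x), norm_sub_sq_real (prox y - x),
      norm_sub_rev (prox x) (prox y)] at h2
    have h3 : (ρ - ρ') * ‖prox y - prox x‖ ^ 2 ≤ ρ * inner ℝ (prox y - prox x) (y - x) := by
      have : inner ℝ (prox y - prox x) (y - x)
          = inner ℝ (prox y - x) (y - x) - inner ℝ (prox x - x) (y - x) := by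
        rw [← inner_sub_left]; congr 1; abel
      rw [this]
      linarith
    have h4 := real_inner_le_norm (prox y - prox x) (y - x)
    rw [div_mul_eq_mul_div, le_div_iff₀ (by linarith)]
    rcases (norm_nonneg (prox y - prox x)).eq_or_lt with h0 | h0
    · rw [← h0]; nlinarith [norm_nonneg (y - x)]
    · refine le_of_mul_le_mul_left ?_ h0
      nlinarith
  set C : ℝ := ρ * (ρ / (ρ - ρ')) + ρ with hC
  have hC0 : 0 ≤ C := by
    have : 0 < ρ - ρ' := by linarith
    positivity
  have hmain : ∀ y, ‖moreau (1 / ρ) φ y - moreau (1 / ρ) φ x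
      - inner ℝ (ρ • (x - prox x)) (y - x)‖ ≤ C * ‖y - x‖ ^ 2 := by
    intro y
    have h1 := (hprox x).moreau_le (hprox y)
    have h2 := (hprox y).moreau_le (hprox x)
    have h3 := real_inner_le_norm (prox y - prox x) (y - x)
    have h4 := mul_le_mul_of_nonneg_right (hlip y) (norm_nonneg (y - x))
    have e0 : inner ℝ (prox y - y) (x - y) = inner ℝ (prox x - x) (x - y)
        - inner ℝ (prox y - prox x) (y - x) + ‖y - x‖ ^ 2 := by
      rw [← real_inner_self_eq_norm_sq, show x - y = -(y - x) by abel, inner_neg_right,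
        inner_neg_right, ← neg_add', ← inner_add_left, neg_add_eq_sub, ← inner_sub_left,
        ← inner_neg_left]
      congr 1
      abel
    have e1 : inner ℝ (ρ • (x - prox x)) (y - x) = - (ρ * inner ℝ (prox x - x) (y - x)) := by
      rw [real_inner_smul_left, ← neg_sub (prox x) x, inner_neg_left]; ring
    have e2 : inner ℝ (prox x - x) (x - y) = - inner ℝ (prox x - x) (y - x) := by
      rw [← neg_sub y x, inner_neg_right]
    rw [e0, e2, norm_sub_rev x y] at h2
    rw [e1, Real.norm_eq_abs, abs_le, hC]
    have h5 := mul_le_mul_of_nonneg_left (h3.trans h4) hρ.le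
    have h6 : 0 ≤ ρ * (ρ / (ρ - ρ')) * ‖y - x‖ ^ 2 := by
      have : 0 < ρ - ρ' := by linarith
      positivity
    have h7 : 0 ≤ ρ * ‖y - x‖ ^ 2 := by positivity
    constructor <;> nlinarith
  rw [hasGradientAt_iff_isLittleO]
  refine Asymptotics.IsBigO.trans_isLittleO (g := fun y => ‖y - x‖ ^ 2)
    (Asymptotics.IsBigO.of_bound C (Filter.Eventually.of_forall fun y => ?_)) ?_
  · rw [Real.norm_of_nonneg (sq_nonneg ‖y - x‖)]
    exact hmain y
  · have := Asymptotics.isLittleO_norm_pow_id (E' := E) one_lt_two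
    have h0 : Filter.Tendsto (fun y : E => y - x) (nhds x) (nhds 0) := by
      have : Continuous fun y : E => y - x := by fun_prop
      simpa using this.tendsto x
    exact this.comp_tendsto h0

end General

/-! ### Uniform random subsets -/

/-- The expectation over uniform subsets of size `B` is invariant under relabelling. -/
theorem expect_subset_map {n B : ℕ} (e : Equiv.Perm (Fin n))
    (f : {b : Finset (Fin n) // b.card = B} → ℝ) :
    𝔼 b, f b = 𝔼 b : {b : Finset (Fin n) // b.card = B},
      f ⟨b.1.map e.toEmbedding, by rw [Finset.card_map]; exact b.2⟩ := by
  symm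
  refine Fintype.expect_equiv (e.finsetCongr.subtypeEquiv fun b => ?_) _ _ fun b => rfl
  simp [Equiv.finsetCongr]

theorem nonempty_subset {n B : ℕ} (hB : B ≤ n) :
    Nonempty {b : Finset (Fin n) // b.card = B} := by
  obtain ⟨b, -, hb⟩ := Finset.exists_subset_card_eq
    (s := (Finset.univ : Finset (Fin n))) (n := B) (by simpa using hB)
  exact ⟨⟨b, hb⟩⟩

/-- An element belongs to a uniform subset of size `B` of `Fin n` with probability `B / n`. -/
theorem expect_mem {n B : ℕ} (hB : B ≤ n) (i : Fin n) :
    (𝔼 b : {b : Finset (Fin n) // b.card = B}, if i ∈ b.1 then (1 : ℝ) else 0)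
      = (B : ℝ) / n := by
  have := nonempty_subset hB
  have hsymm : ∀ k, (𝔼 b : {b : Finset (Fin n) // b.card = B}, if k ∈ b.1 then (1 : ℝ) else 0)
      = 𝔼 b : {b : Finset (Fin n) // b.card = B}, if i ∈ b.1 then (1 : ℝ) else 0 := by
    intro k
    rw [expect_subset_map (Equiv.swap i k)]
    simp only [Finset.mem_map_equiv, Equiv.symm_swap, Equiv.swap_apply_right]
  have hsum : ∑ k : Fin n,
      (𝔼 b : {b : Finset (Fin n) // b.card = B}, if k ∈ b.1 then (1 : ℝ) else 0) = B := by
    rw [← Finset.expect_sum_comm]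
    have : ∀ b : {b : Finset (Fin n) // b.card = B},
        (∑ k : Fin n, if k ∈ b.1 then (1 : ℝ) else 0) = B := by
      intro b
      simp [b.2]
    simp only [this]
    exact Fintype.expect_const _
  simp only [hsymm, Finset.sum_const, Finset.card_univ, Fintype.card_fin, nsmul_eq_mul] at hsum
  have hn : (n : ℝ) ≠ 0 := by
    have := i.pos
    positivity
  rw [eq_div_iff hn, mul_comm]
  exact hsum

theorem expect_sum_subset {n B : ℕ} (hB : B ≤ n) (c : Fin n → ℝ) :
    (𝔼 b : {b : Finset (Fin n) // b.card = B}, ∑ i ∈ b.1, c i) = (B : ℝ) / n * ∑ i, c i := by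
  have h : ∀ b : {b : Finset (Fin n) // b.card = B},
      ∑ i ∈ b.1, c i = ∑ i, (if i ∈ b.1 then (1 : ℝ) else 0) * c i := by
    intro b
    simp
  simp only [h]
  rw [Finset.expect_sum_comm, Finset.mul_sum]
  refine Finset.sum_congr rfl fun i _ => ?_
  rw [← Finset.expect_mul, expect_mem hB]

/-- The mean over a uniform subset is an unbiased estimator of the mean. -/
theorem expect_mean_subset {n B : ℕ} (hB1 : 1 ≤ B) (hB : B ≤ n) (c : Fin n → ℝ) :
    (𝔼 b : {b : Finset (Fin n) // b.card = B}, 1 / (B : ℝ) * ∑ i ∈ b.1, c i)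
      = 1 / (n : ℝ) * ∑ i, c i := by
  rw [← Finset.mul_expect, expect_sum_subset hB, ← mul_assoc]
  have : (B : ℝ) ≠ 0 := by positivity
  congr 1
  field_simp

/-- Two distinct elements belong together to a uniform subset with a probability that does not
depend on them. -/
theorem exists_expect_mem_mem (n B : ℕ) : ∃ q : ℝ, 0 ≤ q ∧ ∀ i j : Fin n, i ≠ j →
    (𝔼 b : {b : Finset (Fin n) // b.card = B},
      (if i ∈ b.1 then (1 : ℝ) else 0) * (if j ∈ b.1 then (1 : ℝ) else 0)) = q := by
  set Q : Fin n → Fin n → ℝ := fun i j => 𝔼 b : {b : Finset (Fin n) // b.card = B},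
      (if i ∈ b.1 then (1 : ℝ) else 0) * (if j ∈ b.1 then (1 : ℝ) else 0) with hQ
  have hnn : ∀ i j, 0 ≤ Q i j := fun i j =>
    Finset.expect_nonneg fun b _ => by positivity
  have hcomm : ∀ i j, Q i j = Q j i := fun i j =>
    Finset.expect_congr rfl fun b _ => mul_comm _ _
  have hswap : ∀ i i' j, i ≠ j → i' ≠ j → Q i j = Q i' j := by
    intro i i' j h h'
    simp only [hQ]
    rw [expect_subset_map (Equiv.swap i i')]
    simp only [Finset.mem_map_equiv, Equiv.symm_swap, Equiv.swap_apply_left,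
      Equiv.swap_apply_of_ne_of_ne h.symm h'.symm]
  by_cases hne : ∃ i j : Fin n, i ≠ j
  · obtain ⟨i₀, j₀, h0⟩ := hne
    refine ⟨Q i₀ j₀, hnn _ _, fun i j hij => ?_⟩
    change Q i j = Q i₀ j₀
    by_cases h1 : i₀ = j
    · subst h1
      rw [hcomm i i₀, hcomm i₀ i, hcomm i₀ j₀]
      exact hswap i j₀ i₀ hij h0.symm
    · rw [hswap i i₀ j hij h1, hcomm i₀ j, hcomm i₀ j₀]
      exact hswap j j₀ i₀ (Ne.symm h1) h0.symm
  · push Not at hne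
    exact ⟨0, le_rfl, fun i j hij => absurd (hne i j) hij⟩

/-- Sampling without replacement: the mean over a uniform subset of size `B` has at most the
variance of a single uniform sample divided by `B`. -/
theorem expect_sq_mean_subset_le {n B : ℕ} (hB1 : 1 ≤ B) (hB : B ≤ n) (c : Fin n → ℝ)
    (hc : ∑ i, c i = 0) :
    (𝔼 b : {b : Finset (Fin n) // b.card = B}, (1 / (B : ℝ) * ∑ i ∈ b.1, c i) ^ 2)
      ≤ 1 / (B : ℝ) * (1 / (n : ℝ) * ∑ i, c i ^ 2) := by
  obtain ⟨q, hq, hqe⟩ := exists_expect_mem_mem n B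
  have hpair : ∀ i j : Fin n, (𝔼 b : {b : Finset (Fin n) // b.card = B},
      (if i ∈ b.1 then (1 : ℝ) else 0) * (if j ∈ b.1 then (1 : ℝ) else 0))
        = q + if i = j then (B : ℝ) / n - q else 0 := by
    intro i j
    split_ifs with h
    · subst h
      simp only [mul_ite, mul_one, mul_zero]
      have := expect_mem hB i
      have e : ∀ b : {b : Finset (Fin n) // b.card = B},
        (if i ∈ b.1 then (if i ∈ b.1 then (1 : ℝ) else 0) else 0)
          = if i ∈ b.1 then (1 : ℝ) else 0 := by intro b; split_ifs <;> rfl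
      simp only [e, this]
      ring
    · rw [hqe i j h, add_zero]
  have h : ∀ b : {b : Finset (Fin n) // b.card = B}, (∑ i ∈ b.1, c i) ^ 2
      = ∑ i, ∑ j, ((if i ∈ b.1 then (1 : ℝ) else 0) * (if j ∈ b.1 then (1 : ℝ) else 0))
          * (c i * c j) := by
    intro b
    have : ∑ i ∈ b.1, c i = ∑ i, (if i ∈ b.1 then (1 : ℝ) else 0) * c i := by simp
    rw [this, sq, Finset.sum_mul_sum]
    exact Finset.sum_congr rfl fun i _ => Finset.sum_congr rfl fun j _ => by ring
  have hE : (𝔼 b : {b : Finset (Fin n) // b.card = B}, (∑ i ∈ b.1, c i) ^ 2)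
      = ((B : ℝ) / n - q) * ∑ i, c i ^ 2 := by
    have h1 : (𝔼 b : {b : Finset (Fin n) // b.card = B}, (∑ i ∈ b.1, c i) ^ 2)
        = ∑ i, ∑ j, (q + if i = j then (B : ℝ) / n - q else 0) * (c i * c j) := by
      simp only [h]
      rw [Finset.expect_sum_comm]
      refine Finset.sum_congr rfl fun i _ => ?_
      rw [Finset.expect_sum_comm]
      refine Finset.sum_congr rfl fun j _ => ?_
      rw [← Finset.expect_mul, hpair]
    rw [h1]
    simp only [add_mul, ite_mul, zero_mul, Finset.sum_add_distrib, Finset.sum_ite_eq,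
      Finset.mem_univ, if_true, ← Finset.mul_sum, hc, mul_zero, zero_add, sq]
  simp only [mul_pow]
  rw [← Finset.mul_expect, hE]
  have hB0 : (0 : ℝ) < B := by positivity
  have hn0 : (0 : ℝ) < n := by
    have : 1 ≤ n := hB1.trans hB
    positivity
  have hS : 0 ≤ ∑ i, c i ^ 2 := Finset.sum_nonneg fun i _ => sq_nonneg _
  calc (1 / (B : ℝ)) ^ 2 * (((B : ℝ) / n - q) * ∑ i, c i ^ 2)
      ≤ (1 / (B : ℝ)) ^ 2 * ((B : ℝ) / n * ∑ i, c i ^ 2) := by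
        gcongr
        linarith
    _ = 1 / (B : ℝ) * (1 / (n : ℝ) * ∑ i, c i ^ 2) := by field_simp

/-- A coordinate that `H` does not look at can be averaged out independently of `H`. -/
theorem expect_pi_eq {ι A S : Type} [Fintype ι] [DecidableEq ι] [Fintype A] [Nonempty A]
    (t : ι) (H : (ι → A) → S) (hH : ∀ ω a, H (Function.update ω t a) = H ω) (G : A → S → ℝ) :
    (𝔼 ω : ι → A, G (ω t) (H ω)) = 𝔼 ω : ι → A, 𝔼 a : A, G a (H ω) := by
  let e : Equiv.Perm ((ι → A) × A) :=
    { toFun := fun x => (Function.update x.1 t x.2, x.1 t)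
      invFun := fun x => (Function.update x.1 t x.2, x.1 t)
      left_inv := fun x => by simp
      right_inv := fun x => by simp }
  have h1 := Finset.expect_product' (Finset.univ : Finset (ι → A)) (Finset.univ : Finset A)
    (fun ω a => G a (H ω))
  have h2 := Finset.expect_product' (Finset.univ : Finset (ι → A)) (Finset.univ : Finset A)
    (fun ω _ => G (ω t) (H ω))
  rw [← h1]
  simp only [Fintype.expect_const] at h2
  rw [← h2, Finset.univ_product_univ]
  refine Fintype.expect_equiv e _ _ fun x => ?_
  simp [e, hH]

/-! ### Products and averages -/

theorem prod2_norm_sq {E F : Type} [NormedAddCommGroup E] [NormedAddCommGroup F] (p : Prod2 E F) :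
    ‖p‖ ^ 2 = ‖p.fst‖ ^ 2 + ‖p.snd‖ ^ 2 := WithLp.prod_norm_sq_eq_of_L2 p

theorem norm_fst_le {E F : Type} [NormedAddCommGroup E] [NormedAddCommGroup F] (p : Prod2 E F) :
    ‖p.fst‖ ≤ ‖p‖ :=
  le_of_sq_le_sq (by rw [prod2_norm_sq]; nlinarith [sq_nonneg ‖p.snd‖]) (norm_nonneg _)

theorem norm_snd_le {E F : Type} [NormedAddCommGroup E] [NormedAddCommGroup F] (p : Prod2 E F) :
    ‖p.snd‖ ≤ ‖p‖ :=
  le_of_sq_le_sq (by rw [prod2_norm_sq]; nlinarith [sq_nonneg ‖p.fst‖]) (norm_nonneg _)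

theorem prod2_inner {E F : Type} [NormedAddCommGroup E] [InnerProductSpace ℝ E]
    [NormedAddCommGroup F] [InnerProductSpace ℝ F] (p q : Prod2 E F) :
    inner ℝ p q = inner ℝ p.fst q.fst + inner ℝ p.snd q.snd := WithLp.prod_inner_apply p q

theorem abs_average_sub_le {m : ℕ} {f g : Fin m → ℝ} {c : ℝ} (hc : 0 ≤ c)
    (h : ∀ j, |f j - g j| ≤ c) : |1 / (m : ℝ) * ∑ j, f j - 1 / (m : ℝ) * ∑ j, g j| ≤ c := by
  rw [← mul_sub, ← Finset.sum_sub_distrib, abs_mul, abs_of_nonneg (by positivity)]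
  have h1 : |∑ j, (f j - g j)| ≤ m * c :=
    (Finset.abs_sum_le_sum_abs _ _).trans
      ((Finset.sum_le_sum fun j _ => h j).trans (by simp))
  calc 1 / (m : ℝ) * |∑ j, (f j - g j)| ≤ 1 / (m : ℝ) * (m * c) := by gcongr
    _ = ((m : ℝ)⁻¹ * m) * c := by ring
    _ ≤ 1 * c := by gcongr; exact inv_mul_le_one
    _ = c := one_mul c

/-! ### Weak convexity of the inner functions and of the objective -/

/-- A monotone, Lipschitz, weakly convex function on the line has at each point a supporting
parabola whose slope there lies between `0` and the Lipschitz constant. -/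
theorem exists_supporting_slope {ρ C : ℝ} {f : ℝ → ℝ} (hm : Monotone f)
    (hC : ∀ x y, |f x - f y| ≤ C * |x - y|) (hf : WeaklyConvex ρ f) (m : ℝ) :
    ∃ v, 0 ≤ v ∧ v ≤ C ∧ ∀ y, f m + v * (y - m) - ρ / 2 * (y - m) ^ 2 ≤ f y := by
  set g : ℝ → ℝ := fun x => f x + ρ / 2 * ‖x‖ ^ 2 with hg
  have hint : m ∈ interior (Set.univ : Set ℝ) := by simp
  -- The right derivative of the convex function `g` is a subgradient, also to the left of `m`.
  set D := derivWithin g (Set.Ioi m) m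
  have hsupp : ∀ y, g m + D * (y - m) ≤ g y := by
    intro y
    rcases lt_trichotomy y m with h | h | h
    · have h1 := (hf.slope_le_leftDeriv_of_mem_interior (Set.mem_univ y) hint h).trans
        (hf.leftDeriv_le_rightDeriv_of_mem_interior hint)
      rw [slope_def_field, div_le_iff₀ (by linarith)] at h1
      simp only [hg, D] at h1 ⊢
      linarith
    · subst h; simp
    · have h1 := hf.rightDeriv_le_slope_of_mem_interior hint (Set.mem_univ y) h
      rw [slope_def_field, le_div_iff₀ (by linarith)] at h1
      simp only [hg, D] at h1 ⊢
      linarith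
  have hpar : ∀ y, f m + (D - ρ * m) * (y - m) - ρ / 2 * (y - m) ^ 2 ≤ f y := by
    intro y
    have := hsupp y
    simp only [hg, Real.norm_eq_abs, sq_abs] at this
    nlinarith
  have hlim : ∀ a b : ℝ, (∀ t : ℝ, 0 < t → a ≤ b + ρ / 2 * t) → a ≤ b := by
    intro a b h
    have : Filter.Tendsto (fun t : ℝ => b + ρ / 2 * t) (nhdsWithin 0 (Set.Ioi 0)) (nhds b) := by
      have hc : Continuous fun t : ℝ => b + ρ / 2 * t := by fun_prop
      simpa using (hc.tendsto 0).mono_left nhdsWithin_le_nhds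
    exact ge_of_tendsto this (eventually_nhdsWithin_of_forall h)
  refine ⟨D - ρ * m, ?_, ?_, hpar⟩
  · refine hlim _ _ fun t ht => ?_
    have h1 := hpar (m - t)
    have h2 := hm (show m - t ≤ m by linarith)
    refine le_of_mul_le_mul_left ?_ ht
    nlinarith
  · refine hlim _ _ fun t ht => ?_
    have h1 := hpar (m + t)
    have h2 := (abs_le.1 (hC (m + t) m)).2
    rw [add_sub_cancel_left, abs_of_pos ht] at h2
    refine le_of_mul_le_mul_left ?_ ht
    nlinarith

/-- Weak convexity of a composition: support `f` by a parabola at the value of `k` at the convex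
combination, and use that its slope lies between `0` and `C`. -/
theorem WeaklyConvex.comp_monotone {E : Type} [NormedAddCommGroup E] [InnerProductSpace ℝ E]
    {ρ C K κ : ℝ} {f : ℝ → ℝ} {k : E → ℝ} (hρ : 0 ≤ ρ) (hκ : 0 ≤ κ) (hm : Monotone f)
    (hC : ∀ x y, |f x - f y| ≤ C * |x - y|) (hf : WeaklyConvex ρ f)
    (hK : ∀ x y, |k x - k y| ≤ K * ‖x - y‖) (hk : WeaklyConvex κ k) :
    WeaklyConvex (ρ * K ^ 2 + C * κ) (fun x => f (k x)) := by
  rw [weaklyConvex_iff] at hk ⊢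
  intro x y a b ha hb hab
  set z := a • x + b • y with hz
  obtain ⟨v, hv0, hvC, hv⟩ := exists_supporting_slope hm hC hf (k z)
  have hxz : ‖x - z‖ = b * ‖x - y‖ := by
    have : x - z = b • (x - y) := by
      rw [hz, show a = 1 - b by linarith]; module
    rw [this, norm_smul, Real.norm_of_nonneg hb]
  have hyz : ‖y - z‖ = a * ‖x - y‖ := by
    have : y - z = -(a • (x - y)) := by
      rw [hz, show b = 1 - a by linarith]; module
    rw [this, norm_neg, norm_smul, Real.norm_of_nonneg ha]
  have h1 : (k x - k z) ^ 2 ≤ K ^ 2 * (b ^ 2 * ‖x - y‖ ^ 2) := by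
    have := hK x z
    rw [hxz] at this
    calc (k x - k z) ^ 2 = |k x - k z| ^ 2 := (sq_abs _).symm
      _ ≤ (K * (b * ‖x - y‖)) ^ 2 := by gcongr
      _ = _ := by ring
  have h2 : (k y - k z) ^ 2 ≤ K ^ 2 * (a ^ 2 * ‖x - y‖ ^ 2) := by
    have := hK y z
    rw [hyz] at this
    calc (k y - k z) ^ 2 = |k y - k z| ^ 2 := (sq_abs _).symm
      _ ≤ (K * (a * ‖x - y‖)) ^ 2 := by gcongr
      _ = _ := by ring
  have h3 := hk x y a b ha hb hab
  have h4 := mul_le_mul_of_nonneg_left (hv (k x)) ha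
  have h5 := mul_le_mul_of_nonneg_left (hv (k y)) hb
  have h6 := mul_le_mul_of_nonneg_left h3 hv0
  have h7 : v * (κ / 2 * (a * b * ‖x - y‖ ^ 2)) ≤ C * (κ / 2 * (a * b * ‖x - y‖ ^ 2)) := by
    gcongr
  have h8 := mul_le_mul_of_nonneg_left h1 (show 0 ≤ a * (ρ / 2) by positivity)
  have h9 := mul_le_mul_of_nonneg_left h2 (show 0 ≤ b * (ρ / 2) by positivity)
  have e : a * (ρ / 2) * (K ^ 2 * (b ^ 2 * ‖x - y‖ ^ 2))
      + b * (ρ / 2) * (K ^ 2 * (a ^ 2 * ‖x - y‖ ^ 2))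
      = ρ * K ^ 2 / 2 * (a * b * ‖x - y‖ ^ 2) * (a + b) := by ring
  have e2 : a * f (k z) + b * f (k z) = f (k z) := by rw [← add_mul, hab, one_mul]
  have e3 : v * (a * k z) + v * (b * k z) = v * k z := by
    rw [← mul_add, ← add_mul, hab, one_mul]
  rw [hab, mul_one] at e
  change f (k z) ≤ _
  linarith

theorem outer_convex_comb {α : ℝ} (hα : 0 < α) (g g' s s' : ℝ) {a b : ℝ} (ha : 0 ≤ a)
    (hb : 0 ≤ b) :
    outer α (a * g + b * g') (a * s + b * s') ≤ a * outer α g s + b * outer α g' s' := by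
  unfold outer
  have h : max (a * g + b * g' - (a * s + b * s')) 0 ≤ a * max (g - s) 0 + b * max (g' - s') 0 := by
    refine max_le ?_ (by positivity)
    nlinarith [le_max_left (g - s) 0, le_max_left (g' - s') 0]
  have h1 := div_le_div_of_nonneg_right h hα.le
  rw [add_div, mul_div_assoc, mul_div_assoc] at h1
  linarith

theorem outer_le_add {α : ℝ} (hα : 0 < α) {g g' e : ℝ} (s : ℝ) (he : 0 ≤ e) (h : g ≤ g' + e) :
    outer α g s ≤ outer α g' s + e / α := by
  unfold outer
  rw [add_assoc, ← add_div]
  gcongr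
  exact max_le (by linarith [le_max_left (g' - s) 0]) (by positivity)

theorem weaklyConvex_outer {α : ℝ} (hα : 0 < α) :
    WeaklyConvex 0 (fun p : Prod2 ℝ ℝ => outer α p.fst p.snd) := by
  rw [weaklyConvex_iff]
  intro x y a b ha hb _
  simpa using outer_convex_comb hα x.fst y.fst x.snd y.snd ha hb

/-- Shifting both arguments of the outer function shifts its value equally, so that a Lipschitz
constant in the first argument gives one in the second. -/
theorem outer_lipschitz {α Cf : ℝ}
    (hf : ∀ g g' s' : ℝ, |outer α g s' - outer α g' s'| ≤ Cf * |g - g'|) (g g' s s' : ℝ) :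
    |outer α g s - outer α g' s'| ≤ Cf * |g - g'| + (1 + Cf) * |s - s'| := by
  have e : outer α (g' + (s - s')) s = outer α g' s' + (s - s') := by
    unfold outer
    rw [show g' + (s - s') - s = g' - s' by ring]
    ring
  have h := hf g (g' + (s - s')) s
  have hC : 0 ≤ Cf := by
    have := hf 1 0 0
    rw [sub_zero, abs_one, mul_one] at this
    exact (abs_nonneg _).trans this
  have h1 : |g - (g' + (s - s'))| ≤ |g - g'| + |s - s'| := by
    rw [← sub_sub]; exact abs_sub _ _
  calc |outer α g s - outer α g' s'|
      = |(outer α g s - outer α (g' + (s - s')) s) + (s - s')| := by rw [e]; congr 1; ring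
    _ ≤ Cf * |g - (g' + (s - s'))| + |s - s'| := (abs_add_le _ _).trans (by gcongr)
    _ ≤ Cf * (|g - g'| + |s - s'|) + |s - s'| := by gcongr
    _ = _ := by ring

theorem one_div_le_of_outer_lipschitz {α Cf : ℝ} (hα : 0 < α)
    (hf : ∀ g g' s' : ℝ, |outer α g s' - outer α g' s'| ≤ Cf * |g - g'|) : 1 / α ≤ Cf := by
  have := hf 1 0 0
  simpa [outer, abs_of_pos hα] using this

namespace Problem

variable {d d₀ np nm : ℕ} {P : Problem d d₀ np nm}

theorem Regular.weaklyConvex_psiSample {Cl ρl Ch ρh : ℝ} (hP : P.Regular Cl ρl Ch ρh)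
    (hβ : 0 < P.β) (hCl : 0 ≤ Cl) (hρl : 0 ≤ ρl) (hρh : 0 ≤ ρh) (i : Fin np) (j : Fin nm) :
    WeaklyConvex ((4 * ρl * Ch ^ 2 + 2 * ρh * Cl) / P.β)
      (fun p : Prod2 (Vec d) ℝ => P.psiSample i j p.fst p.snd) := by
  have hk : WeaklyConvex (2 * ρh) (fun w => P.h w (P.neg j) - P.h w (P.pos i)) := by
    have h1 := hP.neg_wc j
    have h2 := hP.pos_wc i
    rw [weaklyConvex_iff] at h1 h2 ⊢
    intro x y a b ha hb hab
    have := h1 x y a b ha hb hab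
    have := h2 x y a b ha hb hab
    linarith
  have hK : ∀ x y, |(P.h x (P.neg j) - P.h x (P.pos i)) - (P.h y (P.neg j) - P.h y (P.pos i))|
      ≤ 2 * Ch * ‖x - y‖ := by
    intro x y
    have h1 := abs_le.1 (hP.neg_lip j x y)
    have h2 := abs_le.1 (hP.pos_lip i x y)
    rw [abs_le]
    constructor <;> linarith [h1.1, h1.2, h2.1, h2.2]
  have hL := hP.loss_wc.comp_monotone hρl (by positivity) hP.loss_mono hP.loss_lip hK hk
  have e : ρl * (2 * Ch) ^ 2 + Cl * (2 * ρh) = 4 * ρl * Ch ^ 2 + 2 * ρh * Cl := by ring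
  rw [e] at hL
  set μ := 4 * ρl * Ch ^ 2 + 2 * ρh * Cl with hμ
  have hμ0 : 0 ≤ μ := by positivity
  rw [weaklyConvex_iff] at hL ⊢
  intro x y a b ha hb hab
  have h1 := hL x.fst y.fst a b ha hb hab
  have h2 : ‖x.fst - y.fst‖ ^ 2 ≤ ‖x - y‖ ^ 2 := by
    have := norm_fst_le (x - y)
    rw [WithLp.sub_fst] at this
    gcongr
  have h3 : μ / 2 * (a * b * ‖x.fst - y.fst‖ ^ 2) ≤ μ / 2 * (a * b * ‖x - y‖ ^ 2) := by gcongr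
  unfold psiSample
  simp only [WithLp.add_fst, WithLp.smul_fst, WithLp.add_snd, WithLp.smul_snd, smul_eq_mul]
  set lx := P.loss (P.h x.fst (P.neg j) - P.h x.fst (P.pos i))
  set ly := P.loss (P.h y.fst (P.neg j) - P.h y.fst (P.pos i))
  have h4 : max (P.loss (P.h (a • x.fst + b • y.fst) (P.neg j)
        - P.h (a • x.fst + b • y.fst) (P.pos i)) - (a * x.snd + b * y.snd)) 0
      ≤ a * max (lx - x.snd) 0 + b * max (ly - y.snd) 0 + μ / 2 * (a * b * ‖x - y‖ ^ 2) := by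
    refine max_le ?_ (by positivity)
    have := mul_le_mul_of_nonneg_left (le_max_left (lx - x.snd) 0) ha
    have := mul_le_mul_of_nonneg_left (le_max_left (ly - y.snd) 0) hb
    linarith
  have h5 := div_le_div_of_nonneg_right h4 hβ.le
  have e2 : (a * max (lx - x.snd) 0 + b * max (ly - y.snd) 0 + μ / 2 * (a * b * ‖x - y‖ ^ 2)) / P.β
      = a * (max (lx - x.snd) 0 / P.β) + b * (max (ly - y.snd) 0 / P.β)
        + μ / P.β / 2 * (a * b * ‖x - y‖ ^ 2) := by ring
  linarith

theorem Regular.psiWeaklyConvex {Cl ρl Ch ρh : ℝ} (hP : P.Regular Cl ρl Ch ρh)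
    (hβ : 0 < P.β) (hCl : 0 ≤ Cl) (hρl : 0 ≤ ρl) (hρh : 0 ≤ ρh) :
    P.PsiWeaklyConvex ((4 * ρl * Ch ^ 2 + 2 * ρh * Cl) / P.β) := fun i =>
  WeaklyConvex.average (by positivity) fun j => hP.weaklyConvex_psiSample hβ hCl hρl hρh i j

/-- The outer function is convex and non-decreasing in its first argument, with slopes at most
`1 / α`, so that it passes weak convexity on from the inner functions to the objective. -/
theorem PsiWeaklyConvex.objective {ρ : ℝ} (hρ : 0 ≤ ρ) (hα : 0 < P.α) (h : P.PsiWeaklyConvex ρ) :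
    WeaklyConvex (ρ / P.α) P.objective := by
  refine WeaklyConvex.average (φ := fun (i : Fin np) (z : Var d np) =>
    outer P.α (P.psi i z.fst (z.snd.fst i)) z.snd.snd) (by positivity) fun i => ?_
  rw [weaklyConvex_iff]
  intro x y a b ha hb hab
  have h1 := weaklyConvex_iff.1 (h i) (pair x.fst (x.snd.fst i)) (pair y.fst (y.snd.fst i))
    a b ha hb hab
  simp only [WithLp.add_fst, WithLp.smul_fst, WithLp.add_snd, WithLp.smul_snd, smul_eq_mul,
    WithLp.toLp_fst, WithLp.toLp_snd, PiLp.add_apply, PiLp.smul_apply] at h1 ⊢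
  have h2 : ‖pair x.fst (x.snd.fst i) - pair y.fst (y.snd.fst i)‖ ^ 2 ≤ ‖x - y‖ ^ 2 := by
    rw [prod2_norm_sq, prod2_norm_sq, prod2_norm_sq (x - y).snd]
    simp only [WithLp.sub_fst, WithLp.sub_snd, WithLp.toLp_fst, WithLp.toLp_snd]
    have h3 := PiLp.norm_apply_le (x.snd.fst - y.snd.fst) i
    rw [PiLp.sub_apply] at h3
    have h4 : ‖x.snd.fst i - y.snd.fst i‖ ^ 2 ≤ ‖x.snd.fst - y.snd.fst‖ ^ 2 := by gcongr
    linarith [sq_nonneg ‖x.snd.snd - y.snd.snd‖]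
  have h5 : ρ / 2 * (a * b * ‖pair x.fst (x.snd.fst i) - pair y.fst (y.snd.fst i)‖ ^ 2)
      ≤ ρ / 2 * (a * b * ‖x - y‖ ^ 2) := by gcongr
  have h6 := outer_le_add hα (a * x.snd.snd + b * y.snd.snd)
    (show 0 ≤ ρ / 2 * (a * b * ‖x - y‖ ^ 2) by positivity) (h1.trans (add_le_add_right h5 _))
  have h7 := outer_convex_comb hα (P.psi i x.fst (x.snd.fst i)) (P.psi i y.fst (y.snd.fst i))
    x.snd.snd y.snd.snd ha hb
  have e : ρ / 2 * (a * b * ‖x - y‖ ^ 2) / P.α = ρ / P.α / 2 * (a * b * ‖x - y‖ ^ 2) := by ring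
  linarith

/-! ### Lipschitz bounds -/

theorem Regular.abs_psiSample_sub_le {Cl ρl Ch ρh : ℝ} (hP : P.Regular Cl ρl Ch ρh)
    (hβ : 0 < P.β) (hβ1 : P.β ≤ 1) (hCl : 0 ≤ Cl) (hCh : 0 ≤ Ch) (i : Fin np) (j : Fin nm)
    (w w' : Vec d) (s s' : ℝ) :
    |P.psiSample i j w s - P.psiSample i j w' s'|
      ≤ (2 * Cl * Ch + 2) / P.β * (‖w - w'‖ + |s - s'|) := by
  unfold psiSample
  set l := P.loss (P.h w (P.neg j) - P.h w (P.pos i)) with hl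
  set l' := P.loss (P.h w' (P.neg j) - P.h w' (P.pos i)) with hl'
  have h1 : |l - l'| ≤ Cl * (2 * Ch * ‖w - w'‖) := by
    refine (hP.loss_lip _ _).trans (mul_le_mul_of_nonneg_left ?_ hCl)
    have h1 := abs_le.1 (hP.neg_lip j w w')
    have h2 := abs_le.1 (hP.pos_lip i w w')
    rw [abs_le]
    constructor <;> linarith [h1.1, h1.2, h2.1, h2.2]
  have h2 : |max (l - s) 0 - max (l' - s') 0| ≤ |l - l'| + |s - s'| := by
    refine (abs_max_sub_max_le_abs _ _ _).trans ?_
    rw [show l - s - (l' - s') = (l - l') - (s - s') by ring]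
    exact abs_sub _ _
  have h3 : |s - s'| ≤ |s - s'| / P.β := by
    rw [le_div_iff₀ hβ]
    exact mul_le_of_le_one_right (abs_nonneg _) hβ1
  calc |s + max (l - s) 0 / P.β - (s' + max (l' - s') 0 / P.β)|
      = |(s - s') + (max (l - s) 0 - max (l' - s') 0) / P.β| := by congr 1; ring
    _ ≤ |s - s'| + |max (l - s) 0 - max (l' - s') 0| / P.β := by
        refine (abs_add_le _ _).trans ?_
        rw [abs_div, abs_of_pos hβ]
    _ ≤ |s - s'| / P.β + (Cl * (2 * Ch * ‖w - w'‖) + |s - s'|) / P.β := by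
        gcongr
        linarith
    _ = (2 * Cl * Ch * ‖w - w'‖ + 2 * |s - s'|) / P.β := by ring
    _ ≤ ((2 * Cl * Ch + 2) * (‖w - w'‖ + |s - s'|)) / P.β := by
        gcongr
        have : 0 ≤ Cl * Ch * |s - s'| := by positivity
        nlinarith [norm_nonneg (w - w')]
    _ = _ := by ring

variable (P) in
/-- The single-sample inner functions are Lipschitz with constant `L`, for the sum of the norms. -/
def SampleLipschitz (L : ℝ) : Prop :=
  ∀ (i : Fin np) (j : Fin nm) (w w' : Vec d) (s s' : ℝ),
    |P.psiSample i j w s - P.psiSample i j w' s'| ≤ L * (‖w - w'‖ + |s - s'|)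

theorem SampleLipschitz.psi {L : ℝ} (hL : 0 ≤ L) (h : P.SampleLipschitz L) (i : Fin np)
    (w w' : Vec d) (s s' : ℝ) :
    |P.psi i w s - P.psi i w' s'| ≤ L * (‖w - w'‖ + |s - s'|) :=
  abs_average_sub_le (by positivity) fun j => h i j w w' s s'

theorem SampleLipschitz.objective {L Cf : ℝ} (hL : 0 ≤ L) (hCf : 0 ≤ Cf)
    (h : P.SampleLipschitz L)
    (hf : ∀ g g' s' : ℝ, |outer P.α g s' - outer P.α g' s'| ≤ Cf * |g - g'|) (x y : Var d np) :
    |P.objective x - P.objective y| ≤ (2 * Cf * L + (1 + Cf)) * ‖x - y‖ := by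
  refine abs_average_sub_le (by positivity) fun i => ?_
  refine (outer_lipschitz hf _ _ _ _).trans ?_
  have h1 := h.psi hL i x.fst y.fst (x.snd.fst i) (y.snd.fst i)
  have h2 := norm_fst_le (x - y)
  have h3 := (norm_snd_le (x - y).snd).trans (norm_snd_le (x - y))
  have h4 := (norm_fst_le (x - y).snd).trans (norm_snd_le (x - y))
  have h5 := (PiLp.norm_apply_le (x - y).snd.fst i).trans h4
  simp only [WithLp.sub_fst, WithLp.sub_snd, PiLp.sub_apply, Real.norm_eq_abs] at h2 h3 h5
  calc Cf * |P.psi i x.fst (x.snd.fst i) - P.psi i y.fst (y.snd.fst i)|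
        + (1 + Cf) * |x.snd.snd - y.snd.snd|
      ≤ Cf * (L * (‖x - y‖ + ‖x - y‖)) + (1 + Cf) * ‖x - y‖ := by
        gcongr
        exact h1.trans (by gcongr)
    _ = _ := by ring

/-! ### The subgradients chosen by the algorithm -/

variable (O : P.Oracle)

theorem Oracle.outer_le (hα : 0 < P.α) (u s' g s'' : ℝ) :
    outer P.α u s' + (O.df u s').fst * (g - u) + (O.df u s').snd * (s'' - s')
      ≤ outer P.α g s'' := by
  have h := (weaklyConvex_outer hα).le_of_isSubgradient (O.df_spec u s') (pair g s'')
  rw [prod2_inner] at h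
  simp only [WithLp.sub_fst, WithLp.sub_snd, WithLp.toLp_fst, WithLp.toLp_snd, RCLike.inner_apply,
    conj_trivial] at h
  linarith

theorem Oracle.df_fst_nonneg (hα : 0 < P.α) (u s' : ℝ) : 0 ≤ (O.df u s').fst := by
  have h := O.outer_le hα u s' (u - 1) s'
  have h1 : outer P.α (u - 1) s' ≤ outer P.α u s' := by
    simpa using outer_le_add hα (e := 0) s' le_rfl (by linarith : u - 1 ≤ u + 0)
  linarith

theorem Oracle.df_fst_le (hα : 0 < P.α) {Cf : ℝ}
    (hf : ∀ g g' s' : ℝ, |outer P.α g s' - outer P.α g' s'| ≤ Cf * |g - g'|) (u s' : ℝ) :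
    (O.df u s').fst ≤ Cf := by
  have h := O.outer_le hα u s' (u + 1) s'
  have h1 := (abs_le.1 (hf (u + 1) u s')).2
  rw [add_sub_cancel_left, abs_one] at h1
  linarith

/-- The outer function commutes with a common shift of its arguments, so that the two components
of a subgradient add up to `1`. -/
theorem Oracle.abs_df_snd_le (hα : 0 < P.α) {Cf : ℝ}
    (hf : ∀ g g' s' : ℝ, |outer P.α g s' - outer P.α g' s'| ≤ Cf * |g - g'|) (u s' : ℝ) :
    |(O.df u s').snd| ≤ 1 + Cf := by
  have hshift : ∀ t : ℝ, outer P.α (u + t) (s' + t) = outer P.α u s' + t := by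
    intro t
    unfold outer
    rw [add_sub_add_right_eq_sub]
    ring
  have h1 := O.outer_le hα u s' (u + 1) (s' + 1)
  have h2 := O.outer_le hα u s' (u + -1) (s' + -1)
  rw [hshift] at h1 h2
  have h3 := O.df_fst_nonneg hα u s'
  have h4 := O.df_fst_le hα hf u s'
  rw [abs_le]
  constructor <;> linarith

theorem Oracle.norm_dpsi_le {L : ℝ} (hL : 0 ≤ L) (h : P.SampleLipschitz L) (i : Fin np)
    (j : Fin nm) (w : Vec d) (s : ℝ) : ‖O.dpsi i j w s‖ ≤ 2 * L := by
  refine (O.dpsi_spec i j w s).norm_le (by positivity) fun y => ?_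
  have h1 := (abs_le.1 (h i j y.fst w y.snd s)).2
  have h2 := norm_fst_le (y - pair w s)
  have h3 := norm_snd_le (y - pair w s)
  simp only [WithLp.sub_fst, WithLp.sub_snd, WithLp.toLp_fst, WithLp.toLp_snd,
    Real.norm_eq_abs] at h1 h2 h3 ⊢
  refine h1.trans ?_
  nlinarith

theorem Oracle.norm_dpsiBatch_le {L : ℝ} (hL : 0 ≤ L) (h : P.SampleLipschitz L) (i : Fin np)
    (b : Finset (Fin nm)) (w : Vec d) (s : ℝ) : ‖O.dpsiBatch i b w s‖ ≤ 2 * L := by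
  unfold dpsiBatch
  rw [norm_smul, Real.norm_of_nonneg (by positivity)]
  have h1 : ‖∑ j ∈ b, O.dpsi i j w s‖ ≤ b.card * (2 * L) :=
    (norm_sum_le_of_le _ fun j _ => O.norm_dpsi_le hL h i j w s).trans (by simp)
  calc 1 / (b.card : ℝ) * ‖∑ j ∈ b, O.dpsi i j w s‖
      ≤ 1 / (b.card : ℝ) * (b.card * (2 * L)) := by gcongr
    _ = ((b.card : ℝ)⁻¹ * b.card) * (2 * L) := by ring
    _ ≤ 1 * (2 * L) := by gcongr; exact inv_mul_le_one
    _ = 2 * L := one_mul _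

/-- The average of the single-sample subgradients is a subgradient of `ψ_i`. -/
theorem Oracle.psi_le {ρ : ℝ} (h : P.PsiWeaklyConvex ρ) (i : Fin np) (w w' : Vec d) (s s' : ℝ) :
    P.psi i w s + 1 / (nm : ℝ) * ∑ j, inner ℝ (O.dpsi i j w s) (pair (w' - w) (s' - s))
      - ρ / 2 * (‖w' - w‖ ^ 2 + (s' - s) ^ 2) ≤ P.psi i w' s' := by
  have hsub : IsSubgradient (fun p : Prod2 (Vec d) ℝ => P.psi i p.fst p.snd) (pair w s)
      ((1 / (nm : ℝ)) • ∑ j, O.dpsi i j w s) :=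
    (IsSubgradient.sum Finset.univ fun j _ => O.dpsi_spec i j w s).const_mul (by positivity)
  have h1 := (h i).le_of_isSubgradient hsub (pair w' s')
  rw [real_inner_smul_left, sum_inner, prod2_norm_sq] at h1
  simp only [WithLp.sub_fst, WithLp.sub_snd, WithLp.toLp_fst, WithLp.toLp_snd, Real.norm_eq_abs,
    sq_abs] at h1
  exact h1

end Problem

/-! ### Uniform pairs of mini-batches -/

theorem expect_batch {np nm B₁ B₂ : ℕ} (f : Batch np nm B₁ B₂ → ℝ) :
    (𝔼 b, f b) = 𝔼 b₁ : {b : Finset (Fin np) // b.card = B₁},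
      𝔼 b₂ : {b : Finset (Fin nm) // b.card = B₂}, f (b₁, b₂) := by
  rw [← Finset.expect_product', Finset.univ_product_univ]

theorem nonempty_batch {np nm B₁ B₂ : ℕ} (h₁ : B₁ ≤ np) (h₂ : B₂ ≤ nm) :
    Nonempty (Batch np nm B₁ B₂) :=
  have := nonempty_subset h₁
  have := nonempty_subset h₂
  inferInstance

/-- The bias `A` and the sampling noise contribute separately to the second moment. -/
theorem expect_sq_add_mean_subset_le {n B : ℕ} (hB1 : 1 ≤ B) (hB : B ≤ n) (c : Fin n → ℝ)
    (hc : ∑ i, c i = 0) (A : ℝ) :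
    (𝔼 b : {b : Finset (Fin n) // b.card = B}, (A + 1 / (B : ℝ) * ∑ i ∈ b.1, c i) ^ 2)
      ≤ A ^ 2 + 1 / (B : ℝ) * (1 / (n : ℝ) * ∑ i, c i ^ 2) := by
  have := nonempty_subset hB
  have h1 := expect_mean_subset hB1 hB c
  have h2 := expect_sq_mean_subset_le hB1 hB c hc
  rw [hc, mul_zero] at h1
  have e : ∀ b : {b : Finset (Fin n) // b.card = B},
      (A + 1 / (B : ℝ) * ∑ j ∈ b.1, c j) ^ 2
        = A ^ 2 + 2 * A * (1 / (B : ℝ) * ∑ j ∈ b.1, c j)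
          + (1 / (B : ℝ) * ∑ j ∈ b.1, c j) ^ 2 := fun b => by ring
  simp only [e]
  rw [Finset.expect_add_distrib, Finset.expect_add_distrib, ← Finset.mul_expect, h1,
    Fintype.expect_const, mul_zero, add_zero]
  linarith

/-- The expectation over a mini-batch pair of a quantity that depends on whether `i` was drawn. -/
theorem expect_batch_ite {np nm B₁ B₂ : ℕ} (h₁ : B₁ ≤ np) (h₂ : B₂ ≤ nm) (i : Fin np)
    (f : {b : Finset (Fin nm) // b.card = B₂} → ℝ) (c : ℝ) :
    (𝔼 b : Batch np nm B₁ B₂, if i ∈ b.1.1 then f b.2 else c)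
      = (B₁ : ℝ) / np * (𝔼 b₂, f b₂) + (1 - (B₁ : ℝ) / np) * c := by
  have := nonempty_subset h₁
  have := nonempty_subset h₂
  rw [expect_batch]
  have h : ∀ b₁ : {b : Finset (Fin np) // b.card = B₁},
      (𝔼 b₂ : {b : Finset (Fin nm) // b.card = B₂}, if i ∈ b₁.1 then f b₂ else c)
        = (if i ∈ b₁.1 then (1 : ℝ) else 0) * ((𝔼 b₂, f b₂) - c) + c := by
    intro b₁
    split_ifs
    · ring
    · rw [Fintype.expect_const]; ring
  simp only [h]
  rw [Finset.expect_add_distrib, ← Finset.expect_mul, expect_mem h₁, Fintype.expect_const]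
  ring

/-- The average over the drawn pairs of examples is an unbiased estimator of the average over all
pairs of examples. -/
theorem expect_batch_mean {np nm B₁ B₂ : ℕ} (h₁ : 1 ≤ B₁) (h₁' : B₁ ≤ np) (h₂ : 1 ≤ B₂)
    (h₂' : B₂ ≤ nm) (a e : Fin np → ℝ) (c : Fin np → Fin nm → ℝ) :
    (𝔼 b : Batch np nm B₁ B₂, 1 / (B₁ : ℝ) * ∑ i ∈ b.1.1,
        (a i * (1 / (B₂ : ℝ) * ∑ j ∈ b.2.1, c i j) + e i))
      = 1 / (np : ℝ) * ∑ i, (a i * (1 / (nm : ℝ) * ∑ j, c i j) + e i) := by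
  have := nonempty_subset h₂'
  rw [expect_batch, ← expect_mean_subset h₁ h₁']
  refine Finset.expect_congr rfl fun b₁ _ => ?_
  rw [← Finset.mul_expect]
  dsimp only
  rw [Finset.expect_sum_comm]
  congr 1
  refine Finset.sum_congr rfl fun i _ => ?_
  rw [Finset.expect_add_distrib, ← Finset.mul_expect, expect_mean_subset h₂ h₂',
    Fintype.expect_const]

/-- The last increments of `w` and of each `s_i` add up to at most `D`. -/
def State.IncrementLE {d np : ℕ} (D : ℝ) (x : State d np) : Prop :=
  ∀ i, ‖x.w - x.wPrev‖ + |x.s i - x.sPrev i| ≤ D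

/-- The correction weight `γ = g + (1 - τ)` cancels the term linear in the increment `x`, so that the
error `δ` contracts in mean square although its coordinate is refreshed with probability `p` only. -/
theorem msvr_contraction {p τ g δ x : ℝ} (hp : 0 < p) (hp1 : p ≤ 1) (hτ : 0 < τ)
    (hτ2 : τ ≤ 1 / 2) (hg : g = (1 - p) / (p * (1 - τ))) :
    p * ((1 - τ) * δ + g * x) ^ 2 + (1 - p) * (δ - x) ^ 2
      ≤ (1 - p * τ) * δ ^ 2 + 5 / p * x ^ 2 := by
  have h1 : (1 - τ) ≠ 0 := by linarith
  have hg1 : p * (1 - τ) * g = 1 - p := by rw [hg]; field_simp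
  have hg0 : 0 ≤ g := by
    rw [hg]
    exact div_nonneg (by linarith) (mul_nonneg hp.le (by linarith))
  have hpg : p * g ≤ 2 := by nlinarith
  have h2 : p * (p * g ^ 2 + (1 - p)) ≤ 5 := by
    have : (p * g) ^ 2 ≤ 2 ^ 2 := by gcongr
    nlinarith
  have h3 : p * g ^ 2 + (1 - p) ≤ 5 / p := by rw [le_div_iff₀ hp]; linarith
  have e : p * ((1 - τ) * δ + g * x) ^ 2 + (1 - p) * (δ - x) ^ 2
      = (1 - p * τ - p * τ * (1 - τ)) * δ ^ 2 + (p * g ^ 2 + (1 - p)) * x ^ 2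
        + 2 * δ * x * (p * (1 - τ) * g - (1 - p)) := by ring
  rw [e, hg1, sub_self, mul_zero, add_zero]
  have h4 : 0 ≤ p * τ * (1 - τ) * δ ^ 2 := by
    have : 0 ≤ 1 - τ := by linarith
    positivity
  have h5 := mul_le_mul_of_nonneg_right h3 (sq_nonneg x)
  linarith

namespace Problem

variable {d d₀ np nm : ℕ} {P : Problem d d₀ np nm} (O : P.Oracle) {B₁ B₂ : ℕ}

/-! ### Size of a step -/

section StepSize

variable {L Cf η : ℝ} (hα : 0 < P.α) (hL : 0 ≤ L) (hP : P.SampleLipschitz L)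
  (hf : ∀ g g' s' : ℝ, |outer P.α g s' - outer P.α g' s'| ≤ Cf * |g - g'|)
  (hη : 0 ≤ η) (hB₁ : 1 ≤ B₁)

include hα hf hη hB₁

theorem Oracle.abs_step_s'_le (τ γ : ℝ) (b : Batch np nm B₁ B₂) (x : State d np) :
    |(O.step τ γ η b x).s' - x.s'| ≤ η * (1 + Cf) := by
  have hB : (0 : ℝ) < B₁ := by positivity
  have h1 : |∑ i ∈ b.1.1, (O.df (x.u i) x.s').snd| ≤ B₁ * (1 + Cf) := by
    refine (Finset.abs_sum_le_sum_abs _ _).trans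
      ((Finset.sum_le_sum fun i _ => O.abs_df_snd_le hα hf (x.u i) x.s').trans ?_)
    rw [Finset.sum_const, b.1.2, nsmul_eq_mul]
  simp only [Oracle.step]
  rw [sub_sub_cancel_left, abs_neg, abs_mul, abs_of_nonneg (by positivity), mul_assoc]
  gcongr
  rw [one_div, inv_mul_le_iff₀ hB]
  exact h1

include hL hP

theorem Oracle.norm_step_w_le (τ γ : ℝ) (b : Batch np nm B₁ B₂) (x : State d np) :
    ‖(O.step τ γ η b x).w - x.w‖ ≤ η * (2 * L * Cf) := by
  have hB : (0 : ℝ) < B₁ := by positivity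
  have h1 : ‖∑ i ∈ b.1.1, (O.df (x.u i) x.s').fst • (O.dpsiBatch i b.2.1 x.w (x.s i)).fst‖
      ≤ B₁ * (2 * L * Cf) := by
    have h2 : ∀ i ∈ b.1.1,
        ‖(O.df (x.u i) x.s').fst • (O.dpsiBatch i b.2.1 x.w (x.s i)).fst‖ ≤ 2 * L * Cf := by
      intro i _
      have h3 := O.df_fst_nonneg hα (x.u i) x.s'
      have h4 := O.df_fst_le hα hf (x.u i) x.s'
      have h5 := (norm_fst_le _).trans (O.norm_dpsiBatch_le hL hP i b.2.1 x.w (x.s i))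
      rw [norm_smul, Real.norm_of_nonneg h3, mul_comm]
      gcongr
    refine (norm_sum_le_of_le _ h2).trans ?_
    simp [b.1.2]
  simp only [Oracle.step]
  rw [sub_sub_cancel_left, norm_neg, norm_smul, norm_smul, Real.norm_of_nonneg hη,
    Real.norm_of_nonneg (by positivity)]
  refine mul_le_mul_of_nonneg_left ?_ hη
  rw [one_div, inv_mul_le_iff₀ hB]
  exact h1

theorem Oracle.abs_step_s_le (τ γ : ℝ) (b : Batch np nm B₁ B₂) (x : State d np) (i : Fin np) :
    |(O.step τ γ η b x).s i - x.s i|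
      ≤ if i ∈ b.1.1 then η * (1 / (B₁ : ℝ)) * (2 * L * Cf) else 0 := by
  simp only [Oracle.step]
  split_ifs with h
  · have h3 := O.df_fst_nonneg hα (x.u i) x.s'
    have h4 := O.df_fst_le hα hf (x.u i) x.s'
    have h5 := (norm_snd_le _).trans (O.norm_dpsiBatch_le hL hP i b.2.1 x.w (x.s i))
    rw [Real.norm_eq_abs] at h5
    rw [sub_sub_cancel_left, abs_neg, abs_mul, abs_mul (WithLp.snd _), abs_of_nonneg h3,
      abs_of_nonneg (by positivity : 0 ≤ η * (1 / (B₁ : ℝ)))]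
    gcongr
  · simp

theorem Oracle.incrementLE_step (τ γ : ℝ) (b : Batch np nm B₁ B₂) (x : State d np) :
    (O.step τ γ η b x).IncrementLE (2 * (η * (2 * L * Cf))) := by
  intro i
  have h1 := O.norm_step_w_le hα hL hP hf hη hB₁ τ γ b x
  have h2 := O.abs_step_s_le hα hL hP hf hη hB₁ τ γ b x i
  have hM : 0 ≤ η * (2 * L * Cf) := (norm_nonneg _).trans h1
  have h3 : (if i ∈ b.1.1 then η * (1 / (B₁ : ℝ)) * (2 * L * Cf) else 0) ≤ η * (2 * L * Cf) := by
    split_ifs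
    · have : 1 / (B₁ : ℝ) ≤ 1 := by
        rw [div_le_one (by positivity)]
        exact_mod_cast hB₁
      calc η * (1 / (B₁ : ℝ)) * (2 * L * Cf) = 1 / (B₁ : ℝ) * (η * (2 * L * Cf)) := by ring
        _ ≤ 1 * (η * (2 * L * Cf)) := by gcongr
        _ = _ := one_mul _
    · exact hM
  change ‖(O.step τ γ η b x).w - x.w‖ + |(O.step τ γ η b x).s i - x.s i| ≤ _
  linarith

theorem Oracle.norm_step_var_sq_le (τ γ : ℝ) (b : Batch np nm B₁ B₂) (x : State d np) :
    ‖(O.step τ γ η b x).var - x.var‖ ^ 2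
      ≤ η ^ 2 * (2 * (2 * L * Cf) ^ 2 + (1 + Cf) ^ 2) := by
  have h1 := O.norm_step_w_le hα hL hP hf hη hB₁ τ γ b x
  have h2 := O.abs_step_s_le hα hL hP hf hη hB₁ τ γ b x
  have h3 := O.abs_step_s'_le hα hf hη hB₁ τ γ b x
  rw [prod2_norm_sq, prod2_norm_sq (_ - _ : Var d np).snd]
  simp only [State.var, WithLp.sub_fst, WithLp.sub_snd, WithLp.toLp_fst, WithLp.toLp_snd,
    Real.norm_eq_abs]
  have h4 : ‖(O.step τ γ η b x).s - x.s‖ ^ 2 ≤ (η * (2 * L * Cf)) ^ 2 := by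
    rw [EuclideanSpace.norm_sq_eq]
    have h5 : ∀ i, ‖((O.step τ γ η b x).s - x.s) i‖ ^ 2
        ≤ if i ∈ b.1.1 then (η * (1 / (B₁ : ℝ)) * (2 * L * Cf)) ^ 2 else 0 := by
      intro i
      have h6 := h2 i
      rw [PiLp.sub_apply, Real.norm_eq_abs]
      split_ifs with hi
      · rw [if_pos hi] at h6
        gcongr
      · rw [if_neg hi] at h6
        rw [le_antisymm h6 (abs_nonneg _)]
        simp
    refine (Finset.sum_le_sum fun i _ => h5 i).trans ?_
    rw [Finset.sum_ite_mem, Finset.univ_inter, Finset.sum_const, b.1.2, nsmul_eq_mul]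
    have hB : (1 : ℝ) ≤ B₁ := by exact_mod_cast hB₁
    calc (B₁ : ℝ) * (η * (1 / (B₁ : ℝ)) * (2 * L * Cf)) ^ 2
        = 1 / (B₁ : ℝ) * (η * (2 * L * Cf)) ^ 2 := by field_simp
      _ ≤ 1 * (η * (2 * L * Cf)) ^ 2 := by
          gcongr
          rw [div_le_one (by positivity)]
          exact hB
      _ = _ := one_mul _
  have h5 : ‖(O.step τ γ η b x).w - x.w‖ ^ 2 ≤ (η * (2 * L * Cf)) ^ 2 := by gcongr
  have h6 : |(O.step τ γ η b x).s' - x.s'| ^ 2 ≤ (η * (1 + Cf)) ^ 2 := by gcongr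
  linarith

end StepSize

/-! ### One step of the inner estimators -/

variable (P) in
/-- The error of the estimator `u_i`, which tracks `ψ_i` at the previous iterate. -/
def trackingError (i : Fin np) (x : State d np) : ℝ := x.u i - P.psi i x.wPrev (x.sPrev i)

theorem Oracle.expect_trackingError_sq_le {L σ D τ γ η : ℝ} (hL : 0 ≤ L)
    (hP : P.SampleLipschitz L) (hvar : P.BoundedVariance σ) (h₁ : 1 ≤ B₁) (h₁' : B₁ ≤ np)
    (h₂ : 1 ≤ B₂) (h₂' : B₂ ≤ nm) (hτ : 0 < τ) (hτ2 : τ ≤ 1 / 2)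
    (hγ : γ = ((np : ℝ) - (B₁ : ℝ)) / ((B₁ : ℝ) * (1 - τ)) + (1 - τ))
    {x : State d np} (hx : x.IncrementLE D) (i : Fin np) :
    (𝔼 b : Batch np nm B₁ B₂, P.trackingError i (O.step τ γ η b x) ^ 2)
      ≤ (1 - (B₁ : ℝ) / np * τ) * P.trackingError i x ^ 2
        + (2 * ((B₁ : ℝ) / np) * τ ^ 2 * σ ^ 2 / B₂ + 77 * (L * D) ^ 2 / ((B₁ : ℝ) / np)) := by
  have := nonempty_subset h₂'
  have hB₁ : (0 : ℝ) < B₁ := by positivity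
  have hB₂ : (0 : ℝ) < B₂ := by positivity
  have hB₂1 : (1 : ℝ) ≤ B₂ := by exact_mod_cast h₂
  have hnp : (0 : ℝ) < np := hB₁.trans_le (by exact_mod_cast h₁')
  have hnm : (0 : ℝ) < nm := hB₂.trans_le (by exact_mod_cast h₂')
  set p : ℝ := (B₁ : ℝ) / np with hp
  have hp0 : 0 < p := by positivity
  have hp1 : p ≤ 1 := by
    rw [hp, div_le_one hnp]
    exact_mod_cast h₁'
  have hτ1 : 0 < 1 - τ := by linarith
  set g : ℝ := (1 - p) / (p * (1 - τ)) with hg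
  have hγ' : γ = g + (1 - τ) := by
    rw [hγ, hg, hp]
    congr 1
    field_simp
  have hg0 : 0 ≤ g := div_nonneg (by linarith) (by positivity)
  have hγ3 : p * γ ≤ 3 := by
    have h1 : p * (1 - τ) * g = 1 - p := by rw [hg]; field_simp
    have h2 : 0 ≤ p * g * (1 / 2 - τ) := mul_nonneg (by positivity) (by linarith)
    have h3 : p * (1 - τ) ≤ 1 := by nlinarith
    rw [hγ', mul_add]
    linarith
  have hγ0 : 0 ≤ γ := by rw [hγ']; linarith
  set a := P.psi i x.w (x.s i) with ha
  set a' := P.psi i x.wPrev (x.sPrev i) with ha'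
  have hD0 : 0 ≤ D := le_trans (by positivity) (hx i)
  have hLD : 0 ≤ L * D := by positivity
  have haa : |a - a'| ≤ L * D := (hP.psi hL i _ _ _ _).trans (by gcongr; exact hx i)
  -- The sampling noise is the mean over the mini-batch of the centred family `c`.
  set y : Fin nm → ℝ := fun j => P.psiSample i j x.w (x.s i) with hy
  set y' : Fin nm → ℝ := fun j => P.psiSample i j x.wPrev (x.sPrev i) with hy'
  set c : Fin nm → ℝ := fun j => τ * (y j - a) + γ * (y j - y' j - (a - a')) with hc
  have hsum : ∑ j, y j = nm * a := by
    rw [ha, psi]; field_simp; rfl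
  have hsum' : ∑ j, y' j = nm * a' := by
    rw [ha', psi]; field_simp; rfl
  have hc0 : ∑ j, c j = 0 := by
    simp only [hc, Finset.sum_add_distrib, ← Finset.mul_sum, Finset.sum_sub_distrib, hsum, hsum',
      Finset.sum_const, Finset.card_univ, Fintype.card_fin, nsmul_eq_mul]
    ring
  have hc2 : 1 / (nm : ℝ) * ∑ j, c j ^ 2 ≤ 2 * τ ^ 2 * σ ^ 2 + 8 * γ ^ 2 * (L * D) ^ 2 := by
    have h1 : ∀ j, c j ^ 2 ≤ 2 * τ ^ 2 * (y j - a) ^ 2 + 8 * γ ^ 2 * (L * D) ^ 2 := by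
      intro j
      have h2 : |y j - y' j| ≤ L * D := (hP i j _ _ _ _).trans (by gcongr; exact hx i)
      have h3 : |y j - y' j - (a - a')| ≤ 2 * (L * D) := by
        refine (abs_sub _ _).trans ?_
        linarith
      have h4 : (y j - y' j - (a - a')) ^ 2 ≤ (2 * (L * D)) ^ 2 := by
        rw [← sq_abs (y j - y' j - (a - a'))]
        gcongr
      have h5 := mul_le_mul_of_nonneg_left h4 (sq_nonneg γ)
      have h6 : c j ^ 2 ≤ 2 * (τ * (y j - a)) ^ 2 + 2 * (γ * (y j - y' j - (a - a'))) ^ 2 := by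
        simp only [hc]
        nlinarith [sq_nonneg (τ * (y j - a) - γ * (y j - y' j - (a - a')))]
      rw [mul_pow, mul_pow] at h6
      linarith
    have h2 := Finset.sum_le_sum fun j (_ : j ∈ Finset.univ) => h1 j
    rw [Finset.sum_add_distrib, ← Finset.mul_sum, Finset.sum_const, Finset.card_univ,
      Fintype.card_fin, nsmul_eq_mul] at h2
    have h3 := mul_le_mul_of_nonneg_left h2 (show 0 ≤ 1 / (nm : ℝ) by positivity)
    have h4 := mul_le_mul_of_nonneg_left (hvar i x.w (x.s i))
      (show 0 ≤ 2 * τ ^ 2 by positivity)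
    have e : 1 / (nm : ℝ) * (nm * (8 * γ ^ 2 * (L * D) ^ 2)) = 8 * γ ^ 2 * (L * D) ^ 2 := by
      field_simp
    rw [mul_add, e] at h3
    linarith
  -- `A` is the noiseless part of the new error if `i` is drawn.
  set A : ℝ := (1 - τ) * P.trackingError i x + g * (a - a') with hA
  have hstep : ∀ b : Batch np nm B₁ B₂, P.trackingError i (O.step τ γ η b x) ^ 2
      = if i ∈ b.1.1 then (A + 1 / (B₂ : ℝ) * ∑ j ∈ b.2.1, c j) ^ 2
        else (P.trackingError i x - (a - a')) ^ 2 := by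
    intro b
    simp only [trackingError, Oracle.step, psiBatch, b.2.2]
    split_ifs with h
    · congr 1
      simp only [hc, Finset.sum_add_distrib, ← Finset.mul_sum, Finset.sum_sub_distrib,
        Finset.sum_const, b.2.2, nsmul_eq_mul]
      rw [hA, hγ']
      simp only [trackingError, hy, hy', ← ha, ← ha']
      field_simp
      ring
    · congr 1
      ring
  have hnoise : (𝔼 b₂ : {b : Finset (Fin nm) // b.card = B₂},
      (A + 1 / (B₂ : ℝ) * ∑ j ∈ b₂.1, c j) ^ 2)
        ≤ A ^ 2 + 1 / (B₂ : ℝ) * (2 * τ ^ 2 * σ ^ 2 + 8 * γ ^ 2 * (L * D) ^ 2) := by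
    refine (expect_sq_add_mean_subset_le h₂ h₂' c hc0 A).trans ?_
    gcongr
  simp only [hstep]
  rw [expect_batch_ite h₁' h₂' i (fun b₂ => (A + 1 / (B₂ : ℝ) * ∑ j ∈ b₂.1, c j) ^ 2)]
  have h1 := mul_le_mul_of_nonneg_left hnoise hp0.le
  have h2 := msvr_contraction (δ := P.trackingError i x) (x := a - a') hp0 hp1 hτ hτ2 hg
  have h3 : 5 / p * (a - a') ^ 2 ≤ 5 / p * (L * D) ^ 2 := by
    rw [← sq_abs (a - a')]
    gcongr
  -- `8 γ² ≤ 72 / p²` because `p γ ≤ 3`; with the drift `5 / p` this gives the constant `77`.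
  have h4 : p * (1 / (B₂ : ℝ) * (8 * γ ^ 2 * (L * D) ^ 2)) ≤ 72 / p * (L * D) ^ 2 := by
    have h5 : p * (8 * γ ^ 2) ≤ 72 / p := by
      rw [le_div_iff₀ hp0]
      have h6 : (p * γ) ^ 2 ≤ 3 ^ 2 := by gcongr
      linarith
    have h6 : 1 / (B₂ : ℝ) ≤ 1 := by rw [div_le_one hB₂]; exact hB₂1
    calc p * (1 / (B₂ : ℝ) * (8 * γ ^ 2 * (L * D) ^ 2))
        = 1 / (B₂ : ℝ) * (p * (8 * γ ^ 2) * (L * D) ^ 2) := by ring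
      _ ≤ 1 * (72 / p * (L * D) ^ 2) := by gcongr
      _ = _ := one_mul _
  have e1 : p * (A ^ 2 + 1 / (B₂ : ℝ) * (2 * τ ^ 2 * σ ^ 2 + 8 * γ ^ 2 * (L * D) ^ 2))
      = p * A ^ 2 + 2 * p * τ ^ 2 * σ ^ 2 / B₂
        + p * (1 / (B₂ : ℝ) * (8 * γ ^ 2 * (L * D) ^ 2)) := by ring
  have e2 : 77 * (L * D) ^ 2 / p = 5 / p * (L * D) ^ 2 + 72 / p * (L * D) ^ 2 := by ring
  rw [e2]
  rw [e1] at h1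
  rw [← hA] at h2
  linarith

/-! ### One step of the Moreau envelope -/

variable (P) in
/-- The mean error of `u_i` as an estimator of `ψ_i` at the current iterate. -/
def estimationError (x : State d np) : ℝ :=
  1 / (np : ℝ) * ∑ i, |x.u i - P.psi i x.w (x.s i)|

/-- The expected update direction at `x`, tested against `z - x`. -/
def Oracle.meanDirection (x : State d np) (z : Var d np) : ℝ :=
  1 / (np : ℝ) * ∑ i, ((O.df (x.u i) x.s').fst * (1 / (nm : ℝ) *
    ∑ j, inner ℝ (O.dpsi i j x.w (x.s i)) (pair (z.fst - x.w) (z.snd.fst i - x.s i)))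
      + (O.df (x.u i) x.s').snd * (z.snd.snd - x.s'))

/-- The expected update direction is an approximate subgradient of the objective, with an error
governed by that of the inner estimators. -/
theorem Oracle.meanDirection_le (hα : 0 < P.α) {Cf ρψ : ℝ} (hnp : 0 < np) (hρψ : 0 ≤ ρψ)
    (hf : ∀ g g' s' : ℝ, |outer P.α g s' - outer P.α g' s'| ≤ Cf * |g - g'|)
    (hψ : P.PsiWeaklyConvex ρψ) (x : State d np) (z : Var d np) :
    O.meanDirection x z ≤ P.objective z - P.objective x.var + 2 * Cf * P.estimationError x
      + ρψ * Cf / 2 * ‖z - x.var‖ ^ 2 := by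
  have hn : (0 : ℝ) < np := by exact_mod_cast hnp
  have hterm : ∀ i, (O.df (x.u i) x.s').fst * (1 / (nm : ℝ) *
      ∑ j, inner ℝ (O.dpsi i j x.w (x.s i)) (pair (z.fst - x.w) (z.snd.fst i - x.s i)))
        + (O.df (x.u i) x.s').snd * (z.snd.snd - x.s')
      ≤ outer P.α (P.psi i z.fst (z.snd.fst i)) z.snd.snd - outer P.α (P.psi i x.w (x.s i)) x.s'
        + 2 * Cf * |x.u i - P.psi i x.w (x.s i)| + ρψ * Cf / 2 * ‖z - x.var‖ ^ 2 := by
    intro i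
    have h1 := O.outer_le hα (x.u i) x.s' (P.psi i z.fst (z.snd.fst i)) z.snd.snd
    have h2 := O.psi_le hψ i x.w z.fst (x.s i) (z.snd.fst i)
    have h3 := O.df_fst_nonneg hα (x.u i) x.s'
    have h4 := O.df_fst_le hα hf (x.u i) x.s'
    have h5 := (abs_le.1 (hf (x.u i) (P.psi i x.w (x.s i)) x.s')).1
    have h6 : ‖z.fst - x.w‖ ^ 2 + (z.snd.fst i - x.s i) ^ 2 ≤ ‖z - x.var‖ ^ 2 := by
      rw [prod2_norm_sq, prod2_norm_sq (z - x.var).snd]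
      simp only [State.var, WithLp.sub_fst, WithLp.sub_snd, WithLp.toLp_fst, WithLp.toLp_snd]
      have h3 := PiLp.norm_apply_le (z.snd.fst - x.s) i
      rw [PiLp.sub_apply] at h3
      have h4 : ‖z.snd.fst i - x.s i‖ ^ 2 ≤ ‖z.snd.fst - x.s‖ ^ 2 := by gcongr
      rw [Real.norm_eq_abs, sq_abs] at h4
      linarith [sq_nonneg ‖z.snd.snd - x.s'‖]
    set v := (O.df (x.u i) x.s').fst
    have hCf : 0 ≤ Cf := h3.trans h4
    have h7 : v * (ρψ / 2 * (‖z.fst - x.w‖ ^ 2 + (z.snd.fst i - x.s i) ^ 2))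
        ≤ Cf * (ρψ / 2 * ‖z - x.var‖ ^ 2) := by gcongr
    have h8 : v * (x.u i - P.psi i x.w (x.s i)) ≤ Cf * |x.u i - P.psi i x.w (x.s i)| :=
      (mul_le_mul_of_nonneg_left (le_abs_self _) h3).trans (by gcongr)
    have h9 := mul_le_mul_of_nonneg_left h2 h3
    linarith
  have h1 := mul_le_mul_of_nonneg_left (Finset.sum_le_sum fun i (_ : i ∈ Finset.univ) => hterm i)
    (show 0 ≤ 1 / (np : ℝ) by positivity)
  rw [Finset.sum_add_distrib (f := fun i => _ - _ + _), Finset.sum_add_distrib (f := fun i => _ - _),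
    Finset.sum_sub_distrib, ← Finset.mul_sum, Finset.sum_const, Finset.card_univ, Fintype.card_fin,
    nsmul_eq_mul] at h1
  have e : 1 / (np : ℝ) * (np * (ρψ * Cf / 2 * ‖z - x.var‖ ^ 2))
      = ρψ * Cf / 2 * ‖z - x.var‖ ^ 2 := by field_simp
  rw [mul_add, e] at h1
  simp only [meanDirection, objective, estimationError, State.var, WithLp.toLp_fst,
    WithLp.toLp_snd] at h1 ⊢
  linarith

/-- The displacement of one step, tested against `z - x`, as a double average over the
mini-batches. -/
theorem Oracle.inner_step_var (τ γ η : ℝ) (b : Batch np nm B₁ B₂) (x : State d np)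
    (z : Var d np) :
    inner ℝ (z - x.var) ((O.step τ γ η b x).var - x.var)
      = -(η * (1 / (B₁ : ℝ) * ∑ i ∈ b.1.1, ((O.df (x.u i) x.s').fst * (1 / (B₂ : ℝ) *
        ∑ j ∈ b.2.1, inner ℝ (O.dpsi i j x.w (x.s i))
          (pair (z.fst - x.w) (z.snd.fst i - x.s i)))
          + (O.df (x.u i) x.s').snd * (z.snd.snd - x.s')))) := by
  have hdpsi : ∀ i, 1 / (B₂ : ℝ) * ∑ j ∈ b.2.1, inner ℝ (O.dpsi i j x.w (x.s i))
          (pair (z.fst - x.w) (z.snd.fst i - x.s i))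
      = inner ℝ (O.dpsiBatch i b.2.1 x.w (x.s i)).fst (z.fst - x.w)
        + (O.dpsiBatch i b.2.1 x.w (x.s i)).snd * (z.snd.fst i - x.s i) := by
    intro i
    rw [← sum_inner, ← real_inner_smul_left, prod2_inner]
    simp only [dpsiBatch, b.2.2, WithLp.toLp_fst, WithLp.toLp_snd, RCLike.inner_apply,
      conj_trivial]
    ring
  have hs : ∀ i, ((O.step τ γ η b x).s - x.s) i = if i ∈ b.1.1 then
      -(η * (1 / (B₁ : ℝ)) *
        ((O.dpsiBatch i b.2.1 x.w (x.s i)).snd * (O.df (x.u i) x.s').fst)) else 0 := by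
    intro i
    rw [PiLp.sub_apply]
    simp only [Oracle.step]
    split_ifs <;> ring
  rw [prod2_inner, prod2_inner]
  simp only [State.var, WithLp.sub_fst, WithLp.sub_snd, WithLp.toLp_fst, WithLp.toLp_snd,
    PiLp.inner_apply (𝕜 := ℝ) (z.snd.fst - x.s), hs]
  simp only [RCLike.inner_apply, conj_trivial, ite_mul, zero_mul, Finset.sum_ite_mem,
    Finset.univ_inter, hdpsi]
  simp only [Oracle.step, sub_sub_cancel_left, inner_neg_right, real_inner_smul_right, inner_sum,
    PiLp.sub_apply, mul_add, Finset.sum_add_distrib, ← Finset.sum_mul, Finset.mul_sum, neg_mul,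
    Finset.sum_neg_distrib, neg_add, ← add_assoc]
  congr 1
  · congr 1
    · congr 1
      refine Finset.sum_congr rfl fun i _ => ?_
      rw [real_inner_comm]
    · congr 1
      refine Finset.sum_congr rfl fun i _ => ?_
      ring
  · rw [← Finset.mul_sum]
    ring

/-- The expected descent of the Moreau envelope in one step. -/
theorem Oracle.expect_moreau_step_le (hα : 0 < P.α) {L Cf ρψ ρF ρ η : ℝ} (hL : 0 ≤ L)
    (hP : P.SampleLipschitz L) (h₁ : 1 ≤ B₁) (h₁' : B₁ ≤ np) (h₂ : 1 ≤ B₂) (h₂' : B₂ ≤ nm)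
    (hρψ : 0 ≤ ρψ) (hρ : ρ = ρF + ρψ * Cf) (hρ0 : 0 < ρ)
    (hf : ∀ g g' s' : ℝ, |outer P.α g s' - outer P.α g' s'| ≤ Cf * |g - g'|)
    (hψ : P.PsiWeaklyConvex ρψ) (hF : WeaklyConvex ρF P.objective)
    {prox : Var d np → Var d np} (hprox : ∀ z, IsProx ρ P.objective z (prox z))
    (hη : 0 ≤ η) (τ γ : ℝ) (x : State d np) :
    (𝔼 b : Batch np nm B₁ B₂, moreau (1 / ρ) P.objective (O.step τ γ η b x).var)
      ≤ moreau (1 / ρ) P.objective x.var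
        + η * (2 * ρ * Cf * P.estimationError x - 1 / 2 * ‖ρ • (x.var - prox x.var)‖ ^ 2)
        + ρ / 2 * (η ^ 2 * (2 * (2 * L * Cf) ^ 2 + (1 + Cf) ^ 2)) := by
  have := nonempty_batch h₁' h₂'
  set z := prox x.var with hz
  have hb : ∀ b : Batch np nm B₁ B₂, moreau (1 / ρ) P.objective (O.step τ γ η b x).var
      ≤ moreau (1 / ρ) P.objective x.var + ρ * η * (1 / (B₁ : ℝ) * ∑ i ∈ b.1.1,
        ((O.df (x.u i) x.s').fst * (1 / (B₂ : ℝ) *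
        ∑ j ∈ b.2.1, inner ℝ (O.dpsi i j x.w (x.s i))
          (pair (z.fst - x.w) (z.snd.fst i - x.s i)))
          + (O.df (x.u i) x.s').snd * (z.snd.snd - x.s')))
        + ρ / 2 * (η ^ 2 * (2 * (2 * L * Cf) ^ 2 + (1 + Cf) ^ 2)) := by
    intro b
    have h1 := (hprox x.var).moreau_le (hprox (O.step τ γ η b x).var)
    have h2 := O.norm_step_var_sq_le hα hL hP hf hη h₁ τ γ b x
    rw [O.inner_step_var] at h1
    have h3 := mul_le_mul_of_nonneg_left h2 (show 0 ≤ ρ / 2 by positivity)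
    linarith
  refine (Finset.expect_le_expect fun b _ => hb b).trans ?_
  rw [Finset.expect_add_distrib, Finset.expect_add_distrib, Fintype.expect_const,
    Fintype.expect_const, ← Finset.mul_expect, expect_batch_mean h₁ h₁' h₂ h₂']
  have h1 := O.meanDirection_le hα (by omega) hρψ hf hψ x z
  have h2 := (hprox x.var).growth hF x.var
  rw [sub_self, norm_zero, ← hz, norm_sub_rev x.var z] at h2
  have h3 : O.meanDirection x z ≤ 2 * Cf * P.estimationError x - ρ / 2 * ‖z - x.var‖ ^ 2 := by
    have e : (ρ - ρF) / 2 = ρψ * Cf / 2 := by rw [hρ]; ring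
    rw [e] at h2
    linarith
  have h4 := mul_le_mul_of_nonneg_left h3 (show 0 ≤ ρ * η by positivity)
  rw [norm_smul, Real.norm_of_nonneg hρ0.le, norm_sub_rev, mul_pow]
  change moreau (1 / ρ) P.objective x.var + ρ * η * O.meanDirection x z + _ ≤ _
  linarith

end Problem

/-! ### From second moments to the choice of parameters -/

/-- The first absolute moment is bounded by the root of the second moment. -/
theorem expect_abs_le_of_expect_sq_le {ι : Type} [Fintype ι] [Nonempty ι] (f : ι → ℝ)
    {c : ℝ} (hc : 0 ≤ c) (h : (𝔼 i, f i ^ 2) ≤ c ^ 2) : (𝔼 i, |f i|) ≤ c := by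
  refine le_of_sq_le_sq ?_ hc
  set m := 𝔼 i, |f i| with hm
  have h1 : 0 ≤ 𝔼 i, (|f i| - m) ^ 2 := Finset.expect_nonneg fun i _ => sq_nonneg _
  have e : ∀ i, (|f i| - m) ^ 2 = f i ^ 2 - 2 * m * |f i| + m ^ 2 := by
    intro i
    rw [← sq_abs (f i)]
    ring
  simp only [e] at h1
  rw [Finset.expect_add_distrib, Finset.expect_sub_distrib, ← Finset.mul_expect,
    Fintype.expect_const, ← hm] at h1
  linarith

/-- The arithmetic of the parameters: `p = B₁ / n₊`, `y = √B₂`, `r = √cτ`, `A` weighs the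
estimation errors and `b` stands for all the terms of the order of the step size. -/
theorem final_bound_le {A b K0 Δ E₀ σ r cη C p y ε τ η T : ℝ} (hA : 0 < A) (hb : 0 < b)
    (hK0 : 0 ≤ K0) (hr : 0 < r) (hrσ : r ≤ 1 / (8 * A * (|σ| + 1)))
    (hcη : 0 < cη) (hcηr : cη ≤ r / (4 * (40 * A * K0 + b)))
    (hC : C = 8 * |Δ| / cη + 8 * A * |E₀| / r ^ 2 + 1)
    (hp : 0 < p) (hp1 : p ≤ 1) (hy : 1 ≤ y) (hε : 0 < ε) (hτ : τ = r ^ 2 * y ^ 2 * ε ^ 4)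
    (hτ1 : τ ≤ 1 / 2) (hη : η = cη * (p * y * ε ^ 4)) (hT : C * (1 / (p * y) / ε ^ 6) ≤ T) :
    2 * Δ / (η * T) + A * (2 * E₀ / (p * τ * T)
        + √(2 * τ * σ ^ 2 / y ^ 2 + 77 * (4 * K0 * η) ^ 2 / (p ^ 2 * τ)) + 4 * K0 * η) + b * η
      ≤ ε ^ 2 := by
  have hy0 : 0 < y := by linarith
  have hC1 : 1 ≤ C := by
    rw [hC]
    have : 0 ≤ 8 * |Δ| / cη + 8 * A * |E₀| / r ^ 2 := by positivity
    linarith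
  have hη0 : 0 < η := by rw [hη]; positivity
  have hτ0 : 0 < τ := by rw [hτ]; positivity
  have hrye : r * y * ε ^ 2 ≤ 1 := by
    refine le_of_sq_le_sq ?_ zero_le_one
    rw [show (r * y * ε ^ 2) ^ 2 = τ by rw [hτ]; ring]
    linarith
  have hηε : η ≤ cη / r * ε ^ 2 := by
    have : η = cη / r * (p * (r * y * ε ^ 2) * ε ^ 2) := by rw [hη]; field_simp
    rw [this]
    have h1 : p * (r * y * ε ^ 2) ≤ 1 := mul_le_one₀ hp1 (by positivity) hrye
    have h2 : p * (r * y * ε ^ 2) * ε ^ 2 ≤ 1 * ε ^ 2 := by gcongr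
    rw [one_mul] at h2
    gcongr
  have hT0 : 0 < T := lt_of_lt_of_le (by positivity) hT
  have hηT : cη * C / ε ^ 2 ≤ η * T := by
    calc cη * C / ε ^ 2 = η * (C * (1 / (p * y) / ε ^ 6)) := by rw [hη]; field_simp
      _ ≤ η * T := by gcongr
  have hpτT : r ^ 2 * C / ε ^ 2 ≤ p * τ * T := by
    calc r ^ 2 * C / ε ^ 2 = 1 * (r ^ 2 * C / ε ^ 2) := (one_mul _).symm
      _ ≤ y * (r ^ 2 * C / ε ^ 2) := by gcongr
      _ = p * τ * (C * (1 / (p * y) / ε ^ 6)) := by rw [hτ]; field_simp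
      _ ≤ p * τ * T := by gcongr
  have t1 : 2 * Δ / (η * T) ≤ 1 / 4 * ε ^ 2 := by
    have h1 : 8 * |Δ| ≤ cη * C := by
      have : cη * C = 8 * |Δ| + cη * (8 * A * |E₀| / r ^ 2 + 1) := by rw [hC]; field_simp; ring
      have : 0 ≤ cη * (8 * A * |E₀| / r ^ 2 + 1) := by positivity
      linarith
    rw [div_le_iff₀ (by positivity)]
    have h2 : 1 / 4 * ε ^ 2 * (cη * C / ε ^ 2) ≤ 1 / 4 * ε ^ 2 * (η * T) := by gcongr
    have h3 : 1 / 4 * ε ^ 2 * (cη * C / ε ^ 2) = 1 / 4 * (cη * C) := by field_simp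
    linarith [le_abs_self Δ]
  have t2 : A * (2 * E₀ / (p * τ * T)) ≤ 1 / 4 * ε ^ 2 := by
    have h1 : 8 * A * |E₀| ≤ r ^ 2 * C := by
      have : r ^ 2 * C = 8 * A * |E₀| + r ^ 2 * (8 * |Δ| / cη + 1) := by rw [hC]; field_simp; ring
      have : 0 ≤ r ^ 2 * (8 * |Δ| / cη + 1) := by positivity
      linarith
    rw [mul_div_assoc', div_le_iff₀ (by positivity)]
    have h2 : 1 / 4 * ε ^ 2 * (r ^ 2 * C / ε ^ 2) ≤ 1 / 4 * ε ^ 2 * (p * τ * T) := by gcongr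
    have h3 : 1 / 4 * ε ^ 2 * (r ^ 2 * C / ε ^ 2) = 1 / 4 * (r ^ 2 * C) := by field_simp
    have h4 : A * E₀ ≤ A * |E₀| := by gcongr; exact le_abs_self _
    linarith
  have t3 : √(2 * τ * σ ^ 2 / y ^ 2 + 77 * (4 * K0 * η) ^ 2 / (p ^ 2 * τ))
      ≤ 2 * r * |σ| * ε ^ 2 + 36 * K0 * (cη / r) * ε ^ 2 := by
    rw [Real.sqrt_le_left (by positivity)]
    have e : 2 * τ * σ ^ 2 / y ^ 2 + 77 * (4 * K0 * η) ^ 2 / (p ^ 2 * τ)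
        = 2 * (r * |σ| * ε ^ 2) ^ 2 + 1232 * (K0 * (cη / r) * ε ^ 2) ^ 2 := by
      rw [hτ, hη, mul_pow (r * |σ|), mul_pow r, sq_abs]
      field_simp
      ring
    rw [e]
    -- `1232 = 77 · 4² ≤ 36²`
    have h1 : 0 ≤ (r * |σ| * ε ^ 2) * (K0 * (cη / r) * ε ^ 2) := by positivity
    linarith [sq_nonneg (r * |σ| * ε ^ 2), sq_nonneg (K0 * (cη / r) * ε ^ 2)]
  have t4 : 2 * A * r * |σ| ≤ 1 / 4 := by
    rw [le_div_iff₀ (by positivity)] at hrσ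
    have : 0 ≤ A * r := by positivity
    linarith
  have t5 : cη / r * (40 * A * K0 + b) ≤ 1 / 4 := by
    rw [le_div_iff₀ (by positivity)] at hcηr
    rw [div_mul_eq_mul_div, div_le_iff₀ hr]
    linarith
  have h1 := mul_le_mul_of_nonneg_left t3 hA.le
  have h2 := mul_le_mul_of_nonneg_left hηε (show 0 ≤ 4 * A * K0 + b by positivity)
  have h3 := mul_le_mul_of_nonneg_right t4 (sq_nonneg ε)
  have h4 := mul_le_mul_of_nonneg_right t5 (sq_nonneg ε)
  linarith

namespace Problem

variable {d d₀ np nm : ℕ} {P : Problem d d₀ np nm} (O : P.Oracle) {B₁ B₂ T : ℕ}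

/-! ### Expectations along a run -/

theorem Oracle.run_zero (τ γ η : ℝ) (x₀ : State d np) (ω : Fin T → Batch np nm B₁ B₂) :
    O.run τ γ η x₀ ω 0 = x₀ := rfl

theorem Oracle.run_succ (τ γ η : ℝ) (x₀ : State d np) (ω : Fin T → Batch np nm B₁ B₂)
    (t : Fin T) :
    O.run τ γ η x₀ ω t.succ = O.step τ γ η (ω t) (O.run τ γ η x₀ ω t.castSucc) := by
  unfold run
  rw [Fin.induction_succ]

/-- The state before step `t` depends on the earlier mini-batches only. -/
theorem Oracle.run_congr (τ γ η : ℝ) (x₀ : State d np) {ω ω' : Fin T → Batch np nm B₁ B₂}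
    (t : Fin (T + 1)) (h : ∀ k : Fin T, k.castSucc < t → ω k = ω' k) :
    O.run τ γ η x₀ ω t = O.run τ γ η x₀ ω' t := by
  induction t using Fin.induction with
  | zero => rfl
  | succ t ih =>
    rw [run_succ, run_succ, h t (Fin.castSucc_lt_succ (i := t)),
      ih fun k hk => h k (hk.trans (Fin.castSucc_lt_succ (i := t)))]

/-- The mini-batches of step `t` are independent of the state before it. -/
theorem Oracle.expect_run_succ (h₁ : B₁ ≤ np) (h₂ : B₂ ≤ nm) (τ γ η : ℝ) (x₀ : State d np)
    (t : Fin T) (φ : State d np → ℝ) :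
    (𝔼 ω : Fin T → Batch np nm B₁ B₂, φ (O.run τ γ η x₀ ω t.succ))
      = 𝔼 ω : Fin T → Batch np nm B₁ B₂, 𝔼 b : Batch np nm B₁ B₂,
          φ (O.step τ γ η b (O.run τ γ η x₀ ω t.castSucc)) := by
  have := nonempty_batch h₁ h₂
  simp only [run_succ]
  refine expect_pi_eq t (fun ω => O.run τ γ η x₀ ω t.castSucc) (fun ω a => ?_)
    (fun b x => φ (O.step τ γ η b x))
  refine O.run_congr τ γ η x₀ _ fun k hk => ?_
  rw [Function.update_of_ne]
  rintro rfl
  exact lt_irrefl _ hk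

theorem Oracle.incrementLE_run {L Cf η : ℝ} (hα : 0 < P.α) (hL : 0 ≤ L)
    (hP : P.SampleLipschitz L)
    (hf : ∀ g g' s' : ℝ, |outer P.α g s' - outer P.α g' s'| ≤ Cf * |g - g'|)
    (hCf : 0 ≤ Cf) (hη : 0 ≤ η) (hB₁ : 1 ≤ B₁) (τ γ : ℝ) (w₀ : Vec d) (s₀ : Vec np) (s'₀ : ℝ)
    (u₀ : Fin np → ℝ) (ω : Fin T → Batch np nm B₁ B₂) (t : Fin (T + 1)) :
    (O.run τ γ η (State.init w₀ s₀ s'₀ u₀) ω t).IncrementLE (2 * (η * (2 * L * Cf))) := by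
  induction t using Fin.cases with
  | zero =>
    intro i
    rw [run_zero]
    simp only [State.init, sub_self, norm_zero, abs_zero, add_zero]
    positivity
  | succ t =>
    rw [run_succ]
    exact O.incrementLE_step hα hL hP hf hη hB₁ τ γ _ _

theorem estimationError_le {L D : ℝ} (hL : 0 ≤ L) (hP : P.SampleLipschitz L) {x : State d np}
    (hx : x.IncrementLE D) (hnp : 0 < np) :
    P.estimationError x ≤ 1 / (np : ℝ) * ∑ i, |P.trackingError i x| + L * D := by
  have hn : (0 : ℝ) < np := by exact_mod_cast hnp
  have h : ∀ i, |x.u i - P.psi i x.w (x.s i)| ≤ |P.trackingError i x| + L * D := by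
    intro i
    have h1 : |P.psi i x.w (x.s i) - P.psi i x.wPrev (x.sPrev i)| ≤ L * D :=
      (hP.psi hL i _ _ _ _).trans (by gcongr; exact hx i)
    have e : x.u i - P.psi i x.w (x.s i) = P.trackingError i x
        - (P.psi i x.w (x.s i) - P.psi i x.wPrev (x.sPrev i)) := by
      unfold trackingError; ring
    rw [e]
    exact (abs_sub _ _).trans (by gcongr)
  have h1 := mul_le_mul_of_nonneg_left (Finset.sum_le_sum fun i (_ : i ∈ Finset.univ) => h i)
    (show 0 ≤ 1 / (np : ℝ) by positivity)
  rw [Finset.sum_add_distrib, Finset.sum_const, Finset.card_univ, Fintype.card_fin, nsmul_eq_mul,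
    mul_add, ← mul_assoc (1 / (np : ℝ)), one_div_mul_cancel hn.ne', one_mul] at h1
  exact h1

section Run

variable {L Cf σ τ γ η : ℝ} (hα : 0 < P.α) (hL : 0 ≤ L) (hP : P.SampleLipschitz L)
  (hf : ∀ g g' s' : ℝ, |outer P.α g s' - outer P.α g' s'| ≤ Cf * |g - g'|) (hCf : 0 ≤ Cf)
  (hη : 0 ≤ η) (hvar : P.BoundedVariance σ) (h₁ : 1 ≤ B₁) (h₁' : B₁ ≤ np) (h₂ : 1 ≤ B₂)
  (h₂' : B₂ ≤ nm) (hτ : 0 < τ) (hτ2 : τ ≤ 1 / 2)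
  (hγ : γ = ((np : ℝ) - (B₁ : ℝ)) / ((B₁ : ℝ) * (1 - τ)) + (1 - τ))

include hα hL hP hf hCf hη hvar h₁ h₁' h₂ h₂' hτ hτ2 hγ

/-- The mean error of each inner estimator decays geometrically down to a noise floor. -/
theorem Oracle.expect_abs_trackingError_le (w₀ : Vec d) (s₀ : Vec np) (s'₀ : ℝ)
    (u₀ : Fin np → ℝ) (i : Fin np) (t : Fin (T + 1)) :
    (𝔼 ω : Fin T → Batch np nm B₁ B₂,
        |P.trackingError i (O.run τ γ η (State.init w₀ s₀ s'₀ u₀) ω t)|)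
      ≤ (1 - (B₁ : ℝ) / np * τ / 2) ^ (t : ℕ) * |u₀ i - P.psi i w₀ (s₀ i)|
        + √(2 * τ * σ ^ 2 / B₂
          + 77 * (L * (2 * (η * (2 * L * Cf)))) ^ 2 / (((B₁ : ℝ) / np) ^ 2 * τ)) := by
  have := nonempty_batch h₁' h₂'
  have hB₁ : (0 : ℝ) < B₁ := by positivity
  have hnp : (0 : ℝ) < np := hB₁.trans_le (by exact_mod_cast h₁')
  set p : ℝ := (B₁ : ℝ) / np with hp
  have hp0 : 0 < p := by positivity
  have hp1 : p ≤ 1 := by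
    rw [hp, div_le_one hnp]
    exact_mod_cast h₁'
  have hpτ : p * τ ≤ 1 := by nlinarith
  set D := 2 * (η * (2 * L * Cf)) with hD
  set S := 2 * τ * σ ^ 2 / B₂ + 77 * (L * D) ^ 2 / (p ^ 2 * τ) with hS
  have hS0 : 0 ≤ S := by positivity
  set e0 := u₀ i - P.psi i w₀ (s₀ i) with he0
  have hsq : (𝔼 ω : Fin T → Batch np nm B₁ B₂,
      P.trackingError i (O.run τ γ η (State.init w₀ s₀ s'₀ u₀) ω t) ^ 2)
        ≤ (1 - p * τ) ^ (t : ℕ) * e0 ^ 2 + S := by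
    induction t using Fin.induction with
    | zero =>
      simp only [run_zero, Fintype.expect_const, Fin.val_zero, pow_zero, one_mul]
      change e0 ^ 2 ≤ _
      linarith
    | succ t ih =>
      rw [O.expect_run_succ h₁' h₂' τ γ η _ t (fun x => P.trackingError i x ^ 2)]
      refine (Finset.expect_le_expect fun ω _ => O.expect_trackingError_sq_le (η := η) hL hP hvar
        h₁ h₁' h₂ h₂' hτ hτ2 hγ
        (O.incrementLE_run hα hL hP hf hCf hη h₁ τ γ w₀ s₀ s'₀ u₀ ω t.castSucc) i).trans ?_
      rw [Finset.expect_add_distrib, Fintype.expect_const, ← Finset.mul_expect]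
      have e : 2 * p * τ ^ 2 * σ ^ 2 / B₂ + 77 * (L * D) ^ 2 / p = p * τ * S := by
        rw [hS]; field_simp
      rw [← hp, ← hD, e]
      rw [Fin.val_castSucc] at ih
      rw [Fin.val_succ, pow_succ]
      have := mul_le_mul_of_nonneg_left ih (show 0 ≤ 1 - p * τ by linarith)
      linarith
  have hq : 0 ≤ 1 - p * τ / 2 := by linarith
  have hdecay : (1 - p * τ) ^ (t : ℕ) * e0 ^ 2 ≤ ((1 - p * τ / 2) ^ (t : ℕ) * |e0|) ^ 2 := by
    rw [mul_pow, sq_abs, ← pow_mul, mul_comm (t : ℕ) 2, pow_mul]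
    have : 1 - p * τ ≤ (1 - p * τ / 2) ^ 2 := by nlinarith [sq_nonneg (p * τ)]
    have h0 : 0 ≤ 1 - p * τ := by linarith
    gcongr
  refine expect_abs_le_of_expect_sq_le _ (by positivity) (hsq.trans ?_)
  have h1 : 0 ≤ (1 - p * τ / 2) ^ (t : ℕ) * |e0| * √S := by positivity
  nlinarith [Real.sq_sqrt hS0]

theorem Oracle.expect_estimationError_le (w₀ : Vec d) (s₀ : Vec np) (s'₀ : ℝ)
    (u₀ : Fin np → ℝ) (t : Fin (T + 1)) :
    (𝔼 ω : Fin T → Batch np nm B₁ B₂,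
        P.estimationError (O.run τ γ η (State.init w₀ s₀ s'₀ u₀) ω t))
      ≤ (1 - (B₁ : ℝ) / np * τ / 2) ^ (t : ℕ)
          * (1 / (np : ℝ) * ∑ i, |u₀ i - P.psi i w₀ (s₀ i)|)
        + √(2 * τ * σ ^ 2 / B₂
          + 77 * (L * (2 * (η * (2 * L * Cf)))) ^ 2 / (((B₁ : ℝ) / np) ^ 2 * τ))
        + L * (2 * (η * (2 * L * Cf))) := by
  have := nonempty_batch h₁' h₂'
  have hnp : 0 < np := by omega
  have hn : (0 : ℝ) < np := by exact_mod_cast hnp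
  refine (Finset.expect_le_expect fun ω _ => estimationError_le hL hP
    (O.incrementLE_run hα hL hP hf hCf hη h₁ τ γ w₀ s₀ s'₀ u₀ ω t) hnp).trans ?_
  rw [Finset.expect_add_distrib, Fintype.expect_const, ← Finset.mul_expect,
    Finset.expect_sum_comm]
  have h := mul_le_mul_of_nonneg_left (Finset.sum_le_sum fun i (_ : i ∈ Finset.univ) =>
    O.expect_abs_trackingError_le hα hL hP hf hCf hη hvar h₁ h₁' h₂ h₂' hτ hτ2 hγ w₀ s₀ s'₀ u₀ i t)
    (show 0 ≤ 1 / (np : ℝ) by positivity)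
  rw [Finset.sum_add_distrib, Finset.sum_const, Finset.card_univ, Fintype.card_fin, nsmul_eq_mul,
    mul_add, ← mul_assoc (1 / (np : ℝ)) (np : ℝ), one_div_mul_cancel hn.ne', one_mul,
    ← Finset.mul_sum] at h
  linarith

/-- The non-asymptotic convergence bound, for arbitrary step sizes. -/
theorem Oracle.expectOutput_le {ρψ ρF ρ Δ E₀ : ℝ} (hη0 : 0 < η) (hT : 0 < T)
    (hρψ : 0 ≤ ρψ) (hρ : ρ = ρF + ρψ * Cf) (hρ0 : 0 < ρ)
    (hψ : P.PsiWeaklyConvex ρψ) (hF : WeaklyConvex ρF P.objective)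
    {prox : Var d np → Var d np} (hprox : ∀ z, IsProx ρ P.objective z (prox z))
    (w₀ : Vec d) (s₀ : Vec np) (s'₀ : ℝ) (u₀ : Fin np → ℝ)
    (hE₀ : 1 / (np : ℝ) * ∑ i, |u₀ i - P.psi i w₀ (s₀ i)| ≤ E₀)
    (hΔ : ∀ z, moreau (1 / ρ) P.objective (pair w₀ (pair s₀ s'₀))
      - moreau (1 / ρ) P.objective z ≤ Δ) :
    O.expectOutput B₁ B₂ T τ γ η (State.init w₀ s₀ s'₀ u₀) (fun z => ‖ρ • (z - prox z)‖ ^ 2)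
      ≤ 2 * Δ / (η * T) + 4 * ρ * Cf * (2 * E₀ / ((B₁ : ℝ) / np * τ * T)
          + √(2 * τ * σ ^ 2 / B₂
            + 77 * (L * (2 * (η * (2 * L * Cf)))) ^ 2 / (((B₁ : ℝ) / np) ^ 2 * τ))
          + L * (2 * (η * (2 * L * Cf))))
        + ρ * (2 * (2 * L * Cf) ^ 2 + (1 + Cf) ^ 2) * η := by
  have := nonempty_batch h₁' h₂'
  have hB₁ : (0 : ℝ) < B₁ := by positivity
  have hnp : (0 : ℝ) < np := hB₁.trans_le (by exact_mod_cast h₁')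
  have hT0 : (0 : ℝ) < T := by exact_mod_cast hT
  set p : ℝ := (B₁ : ℝ) / np with hp
  have hp0 : 0 < p := by positivity
  have hp1 : p ≤ 1 := by
    rw [hp, div_le_one hnp]
    exact_mod_cast h₁'
  have hpτ : p * τ ≤ 1 := by nlinarith
  set N := √(2 * τ * σ ^ 2 / B₂ + 77 * (L * (2 * (η * (2 * L * Cf)))) ^ 2 / (p ^ 2 * τ))
    + L * (2 * (η * (2 * L * Cf))) with hN
  set K := 2 * (2 * L * Cf) ^ 2 + (1 + Cf) ^ 2 with hK
  set x₀ := State.init w₀ s₀ s'₀ u₀ with hx₀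
  let m : Fin (T + 1) → ℝ := fun t =>
    𝔼 ω : Fin T → Batch np nm B₁ B₂, moreau (1 / ρ) P.objective (O.run τ γ η x₀ ω t).var
  let G : Fin T → ℝ := fun t => 𝔼 ω : Fin T → Batch np nm B₁ B₂,
    ‖ρ • ((O.run τ γ η x₀ ω t.castSucc).var - prox (O.run τ γ η x₀ ω t.castSucc).var)‖ ^ 2
  have hE₀0 : 0 ≤ E₀ := le_trans (by positivity) hE₀
  have hq : 0 ≤ 1 - p * τ / 2 := by linarith
  have hstep : ∀ t : Fin T, η / 2 * G t ≤ m t.castSucc - m t.succ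
      + η * (2 * ρ * Cf) * ((1 - p * τ / 2) ^ (t : ℕ) * E₀ + N) + ρ / 2 * (η ^ 2 * K) := by
    intro t
    have h1 := O.expect_run_succ h₁' h₂' τ γ η x₀ t
      (fun x => moreau (1 / ρ) P.objective x.var)
    have h2 := Finset.expect_le_expect fun (ω : Fin T → Batch np nm B₁ B₂)
      (_ : ω ∈ Finset.univ) => O.expect_moreau_step_le hα hL hP h₁ h₁' h₂ h₂' hρψ hρ hρ0 hf hψ hF
        hprox hη τ γ (O.run τ γ η x₀ ω t.castSucc)
    rw [← h1, Finset.expect_add_distrib, Finset.expect_add_distrib, Fintype.expect_const,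
      ← Finset.mul_expect, Finset.expect_sub_distrib, ← Finset.mul_expect,
      ← Finset.mul_expect] at h2
    have h3 := O.expect_estimationError_le hα hL hP hf hCf hη hvar h₁ h₁' h₂ h₂' hτ hτ2 hγ
      w₀ s₀ s'₀ u₀ t.castSucc
    have h4 : (1 - p * τ / 2) ^ (t : ℕ) * (1 / (np : ℝ) * ∑ i, |u₀ i - P.psi i w₀ (s₀ i)|)
        ≤ (1 - p * τ / 2) ^ (t : ℕ) * E₀ := by gcongr
    rw [Fin.val_castSucc, ← hp, ← hx₀, add_assoc, ← hN] at h3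
    have h5 := mul_le_mul_of_nonneg_left (h3.trans (add_le_add_left h4 N))
      (show 0 ≤ η * (2 * ρ * Cf) by positivity)
    simp only [m, G]
    linarith
  have htel : ∑ t : Fin T, (m t.castSucc - m t.succ) = m 0 - m (Fin.last T) := by
    have h1 := Fin.sum_univ_succ m
    have h2 := Fin.sum_univ_castSucc m
    rw [Finset.sum_sub_distrib]
    linarith
  have hm : m 0 - m (Fin.last T) ≤ Δ := by
    have h1 : m 0 - m (Fin.last T) = 𝔼 ω : Fin T → Batch np nm B₁ B₂,
        (moreau (1 / ρ) P.objective (pair w₀ (pair s₀ s'₀))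
          - moreau (1 / ρ) P.objective (O.run τ γ η x₀ ω (Fin.last T)).var) := by
      rw [Finset.expect_sub_distrib]
      rfl
    rw [h1]
    exact Finset.expect_le Finset.univ_nonempty fun ω _ => hΔ _
  have hgeom : ∑ t : Fin T, (1 - p * τ / 2) ^ (t : ℕ) ≤ 2 / (p * τ) := by
    rw [Fin.sum_univ_eq_sum_range (fun t => (1 - p * τ / 2) ^ t)]
    have h1 := mul_neg_geom_sum (1 - p * τ / 2) T
    rw [le_div_iff₀ (by positivity)]
    have h2 : 0 ≤ (1 - p * τ / 2) ^ T := by positivity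
    linarith
  have hsum := Finset.sum_le_sum fun t (_ : t ∈ Finset.univ) => hstep t
  rw [← Finset.mul_sum, Finset.sum_add_distrib, Finset.sum_add_distrib, htel, ← Finset.mul_sum,
    Finset.sum_add_distrib, ← Finset.sum_mul, Finset.sum_const, Finset.sum_const,
    Finset.card_univ, Fintype.card_fin, nsmul_eq_mul, nsmul_eq_mul] at hsum
  have hgeom' := mul_le_mul_of_nonneg_left (mul_le_mul_of_nonneg_right hgeom hE₀0)
    (show 0 ≤ η * (2 * ρ * Cf) by positivity)
  have hfin : η / 2 * ∑ t, G t ≤ Δ + η * (2 * ρ * Cf) * (2 / (p * τ) * E₀ + T * N)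
      + T * (ρ / 2 * (η ^ 2 * K)) := by linarith
  have hout : O.expectOutput B₁ B₂ T τ γ η x₀ (fun z => ‖ρ • (z - prox z)‖ ^ 2)
      = (∑ t, G t) / T := by
    unfold expectOutput
    rw [Fintype.expect_eq_sum_div_card, Fintype.card_fin]
  rw [hout, div_le_iff₀ hT0]
  refine le_of_mul_le_mul_left (hfin.trans (le_of_eq ?_)) (show 0 < η / 2 by positivity)
  rw [add_assoc _ (√_), ← hN]
  field_simp
  ring

end Run

end Problem

end TPAUC

end

theorem theorem6
    (α β Cl ρl Ch ρh : ℝ) (hα : 0 < α) (hα1 : α ≤ 1) (hβ : 0 < β) (hβ1 : β ≤ 1)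
    (hCl : 0 ≤ Cl) (hρl : 0 ≤ ρl) (hCh : 0 ≤ Ch) (hρh : 0 ≤ ρh) :
    -- the weak convexity moduli of the inner functions and of the objective exist
    (∀ (d d₀ np nm : ℕ) (P : TPAUC.Problem d d₀ np nm), P.α = α → P.β = β →
      P.Regular Cl ρl Ch ρh →
        P.PsiWeaklyConvex ((4 * ρl * Ch ^ 2 + 2 * ρh * Cl) / β) ∧
        TPAUC.WeaklyConvex ((4 * ρl * Ch ^ 2 + 2 * ρh * Cl) / (α * β)) P.objective) ∧
    -- convergence, for all such moduli `ρψ`, `ρF` and every Lipschitz constant `Cf` of `f(·, s')`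
    ∀ Cf ρψ ρF ρbar σ Δ E₀ : ℝ,
      (∀ g g' s' : ℝ, |TPAUC.outer α g s' - TPAUC.outer α g' s'| ≤ Cf * |g - g'|) →
      0 ≤ ρψ → 0 ≤ ρF → ρbar = ρF + ρψ * Cf → 0 < ρbar →
      ∃ c₁ : ℝ, 0 < c₁ ∧ ∀ cτ : ℝ, 0 < cτ → cτ ≤ c₁ →
      ∃ c₂ : ℝ, 0 < c₂ ∧ ∀ cη : ℝ, 0 < cη → cη ≤ c₂ →
      ∃ C : ℝ, 0 < C ∧
        ∀ (d d₀ np nm : ℕ) (P : TPAUC.Problem d d₀ np nm), P.α = α → P.β = β →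
          P.Regular Cl ρl Ch ρh → P.PsiWeaklyConvex ρψ → TPAUC.WeaklyConvex ρF P.objective →
          P.BoundedVariance σ →
        ∀ (O : P.Oracle) (w₀ : TPAUC.Vec d) (s₀ : TPAUC.Vec np) (s'₀ : ℝ) (u₀ : Fin np → ℝ),
          1 / (np : ℝ) * ∑ i : Fin np, |u₀ i - P.psi i w₀ (s₀ i)| ≤ E₀ →
          (∀ z : TPAUC.Var d np,
            TPAUC.moreau (1 / ρbar) P.objective (TPAUC.pair w₀ (TPAUC.pair s₀ s'₀))
              - TPAUC.moreau (1 / ρbar) P.objective z ≤ Δ) →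
        ∀ (B₁ B₂ : ℕ), 1 ≤ B₁ → B₁ ≤ np → 1 ≤ B₂ → B₂ ≤ nm →
        ∀ (ε τ γ η : ℝ), 0 < ε →
          τ = cτ * (B₂ : ℝ) * ε ^ 4 → τ ≤ 1 / 2 →
          η = cη * ((B₁ : ℝ) * √(B₂ : ℝ) * ε ^ 4 / (np : ℝ)) →
          γ = ((np : ℝ) - (B₁ : ℝ)) / ((B₁ : ℝ) * (1 - τ)) + (1 - τ) →
        ∀ T : ℕ, C * ((np : ℝ) / ((B₁ : ℝ) * √(B₂ : ℝ)) / ε ^ 6) ≤ (T : ℝ) →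
          Differentiable ℝ (TPAUC.moreau (1 / ρbar) P.objective) ∧
          O.expectOutput B₁ B₂ T τ γ η (TPAUC.State.init w₀ s₀ s'₀ u₀)
            (fun z => ‖gradient (TPAUC.moreau (1 / ρbar) P.objective) z‖ ^ 2) ≤ ε ^ 2 := by
  refine ⟨?_, ?_⟩
  · rintro d d₀ np nm P rfl rfl hP
    have h := hP.psiWeaklyConvex hβ hCl hρl hρh
    refine ⟨h, ?_⟩
    rw [mul_comm P.α, ← div_div]
    exact h.objective (by positivity) hα
  intro Cf ρψ ρF ρ σ Δ E₀ hf hρψ hρF hρ hρ0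
  have hCfα := TPAUC.one_div_le_of_outer_lipschitz hα hf
  have hCf : 0 < Cf := lt_of_lt_of_le (by positivity) hCfα
  set L : ℝ := (2 * Cl * Ch + 2) / β with hL
  have hL0 : 0 ≤ L := by positivity
  set A : ℝ := 4 * ρ * Cf with hA
  have hA0 : 0 < A := by positivity
  set b : ℝ := ρ * (2 * (2 * L * Cf) ^ 2 + (1 + Cf) ^ 2) with hb
  have hb0 : 0 < b := by positivity
  -- `final_bound_le` bounds each of four contributions to the error by `ε ² / 4`.
  refine ⟨(1 / (8 * A * (|σ| + 1))) ^ 2, by positivity, fun cτ hcτ hcτ1 => ?_⟩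
  set r : ℝ := √cτ with hr
  have hr0 : 0 < r := Real.sqrt_pos.2 hcτ
  have hrσ : r ≤ 1 / (8 * A * (|σ| + 1)) := Real.sqrt_le_iff.2 ⟨by positivity, hcτ1⟩
  refine ⟨r / (4 * (40 * A * (L ^ 2 * Cf) + b)), by positivity, fun cη hcη hcη2 => ?_⟩
  refine ⟨8 * |Δ| / cη + 8 * A * |E₀| / r ^ 2 + 1, by positivity, ?_⟩
  rintro d d₀ np nm P rfl rfl hreg hψ hF hvar O w₀ s₀ s'₀ u₀ hE₀ hΔ B₁ B₂ h₁ h₁' h₂ h₂'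
    ε τ γ η hε hτ hτ2 hη hγ T hT
  have hB₁ : (0 : ℝ) < B₁ := by positivity
  have hB₂ : (0 : ℝ) < B₂ := by positivity
  have hnp : (0 : ℝ) < np := hB₁.trans_le (by exact_mod_cast h₁')
  have hP : P.SampleLipschitz L := hreg.abs_psiSample_sub_le hβ hβ1 hCl hCh
  have hτ0 : 0 < τ := by rw [hτ]; positivity
  have hη0 : 0 < η := by rw [hη]; positivity
  have hT0 : (0 : ℝ) < T := lt_of_lt_of_le (by positivity) hT
  -- If `ρψ = 0` then `ρF = ρ`, but in that case the objective is convex.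
  have hF' : ∃ ρ' < ρ, TPAUC.WeaklyConvex ρ' P.objective := by
    rcases hρψ.eq_or_lt with h0 | h0
    · refine ⟨ρψ / P.α, ?_, hψ.objective hρψ hα⟩
      rwa [← h0, zero_div]
    · exact ⟨ρF, by rw [hρ]; linarith [mul_pos h0 hCf], hF⟩
  obtain ⟨ρ', hρ', hF'⟩ := hF'
  choose prox hprox using fun z => TPAUC.exists_isProx hρ0
    (show 0 ≤ 2 * Cf * L + (1 + Cf) by positivity) (hP.objective hL0 hCf.le hf) z
  have hgrad := TPAUC.IsProx.hasGradientAt hρ0 hρ' hF' hprox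
  refine ⟨fun z => (hgrad z).differentiableAt, ?_⟩
  have hg : gradient (TPAUC.moreau (1 / ρ) P.objective) = fun z => ρ • (z - prox z) :=
    funext fun z => (hgrad z).gradient
  rw [hg]
  refine (O.expectOutput_le hα hL0 hP hf hCf.le hη0.le hvar h₁ h₁' h₂ h₂' hτ0 hτ2 hγ hη0
    (by exact_mod_cast hT0) hρψ hρ hρ0 hψ hF hprox w₀ s₀ s'₀ u₀ hE₀ hΔ).trans ?_
  have hp : 1 / ((B₁ : ℝ) / np * √(B₂ : ℝ)) = (np : ℝ) / ((B₁ : ℝ) * √(B₂ : ℝ)) := by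
    field_simp
  have hfinal := TPAUC.final_bound_le (p := (B₁ : ℝ) / np) (y := √(B₂ : ℝ)) (ε := ε) (τ := τ)
    (η := η) (T := T) hA0 hb0 (by positivity) hr0 hrσ hcη hcη2 rfl (by positivity)
    ((div_le_one hnp).2 (by exact_mod_cast h₁'))
    (Real.one_le_sqrt.2 (by exact_mod_cast h₂)) hε
    (by rw [hτ, Real.sq_sqrt hcτ.le, Real.sq_sqrt hB₂.le]) hτ2
    (by rw [hη]; ring) (by rw [hp]; exact hT)
  rw [Real.sq_sqrt hB₂.le] at hfinal
  have e : L * (2 * (η * (2 * L * Cf))) = 4 * (L ^ 2 * Cf) * η := by ring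
  rw [e]
  exact hfinal
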